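/- **Setting.** Let $d\ge m\ge 1$ be integers, let $\Omega=\Omega^1\times\dots\times\Omega^d$ with each $\Omega^j$ equal to $\mathbb R$ or $\mathbb R_+=[0,\infty)$, with Lebesgue measure, and let $0=l_0<l_1<\dots<l_m=d$ be integers. Write $x=(x_1,\dots,x_d)=(\tilde x_1,\dots,\tilde x_m)$ with $\tilde x_i=(x_{l_{i-1}+1},\dots,x_{l_i})$ and put $\tilde\Omega^i=\Omega^{l_{i-1}+1}\times\dots\times\Omega^{l_i}$. Let $k(1),\dots,k(d)\in\{1,2,\dots\}$ and, for $n\in\mathbb Z$, let $\tilde C^i_n=[0,2^{-nk(l_{i-1}+1)})\times\dots\times[0,2^{-nk(l_i)})$ and $C_n=\tilde C^1_n\times\dots\times\tilde C^m_n$. For $p\in(1,\infty)$, a measurable function $w$ on $\tilde\Omega^i$ with $0<w<\infty$ almost everywhere is an $A_p$-weight, $w\in A_p(\tilde\Omega^i)$, if $$[w]_p=\sup_{C}\Big(\frac1{|C|}\int_C w\,dx\Big)\Big(\frac1{|C|}\int_C w^{-1/(p-1)}\,dx\Big)^{p-1}<\infty ,$$ the supremum being over all translates $C$ of the boxes $\tilde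 C^i_n$, $n\in\mathbb Z$, that are contained in $\tilde\Omega^i$. The class $A_p(\Omega)$ and its $[w]_p$ are defined in the same way with the translates of $C_n$, $n\in\mathbb Z$, that are contained in $\Omega$. The mixed norm is $$\|f\|_{L_{p_1,\dots,p_m}(w^1,\dots,w^m)}=\bigg(\int_{\tilde\Omega^m}\Big(\cdots\Big(\int_{\tilde\Omega^2}\Big(\int_{\tilde\Omega^1}|f|^{p_1}w^1(\tilde x_1)\,d\tilde x_1\Big)^{p_2/p_1}w^2(\tilde x_2)\,d\tilde x_2\Big)^{p_3/p_2}\cdots\Big)^{p_m/p_{m-1}}w^m(\tilde x_m)\,d\tilde x_m\bigg)^{1/p_m},$$ and $\|f\|_{L_p(w\,dx)}=\big(\int_\Omega|f|^pw\,dx\big)^{1/p}$; norms may be infinite. **Theorem.** Let $K_0,p_1,\dots,p_m\in(1,\infty)$. There is a constant $\Lambda_0\ge1$, depending only on $d,p_1,\dots,p_m,k(1),\dots,k(d),K_0$, and for every $N_0\in(0,\infty)$ there is a constant $N\in(0,\infty)$, depending only on the same data and $N_0$, such that the following holds. Let $w^i\in A_{p_i}(\tilde\Omega^i)$ with $[w^i]_{p_i}\le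 K_0$ for $i=1,\dots,m$, and let $u,g$ be real-valued measurable functions on $\Omega$ such that $$\|u\|_{L_{p_1}(w\,dx)}\le N_0\|g\|_{L_{p_1}(w\,dx)}\qquad\text{for every } w\in A_{p_1}(\Omega)\text{ with }[w]_{p_1}\le\Lambda_0 .$$ Then $$\|u\|_{L_{p_1,\dots,p_m}(w^1,\dots,w^m)}\le N\,\|g\|_{L_{p_1,\dots,p_m}(w^1,\dots,w^m)} .$$ In particular $\Lambda_0$ and $N$ do not depend on the choice of the $\Omega^j$ and of the $l_i$. -/

import Mathlib

open MeasureTheory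
open scoped ENNReal

noncomputable section

namespace MixedExtrapolation

/-- The product domain `∏ j, Ω j` inside `ι → ℝ`. -/
def domain {ι : Type*} (Ω : ι → Set ℝ) : Set (ι → ℝ) :=
  Set.univ.pi Ω

/-- The translate by `a` of the anisotropic dyadic box `∏ j, [0, 2 ^ (-n k(j)))`. -/
def box {ι : Type*} (k : ι → ℕ) (n : ℤ) (a : ι → ℝ) : Set (ι → ℝ) :=
  Set.univ.pi fun j => Set.Ico (a j) (a j + (2 : ℝ) ^ (-(n * (k j : ℤ))))

/-- The characteristic `[w]_p` of `w` relative to all translates of the boxes that lie in the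
domain: the supremum of `(⨍ w) * (⨍ w ^ (-1/(p-1))) ^ (p-1)`, as an extended number. -/
def apConst {ι : Type*} [Fintype ι] (Ω : ι → Set ℝ) (k : ι → ℕ) (p : ℝ)
    (w : (ι → ℝ) → ℝ) : ℝ≥0∞ :=
  ⨆ (n : ℤ) (a : ι → ℝ) (_ : box k n a ⊆ domain Ω),
    (⨍⁻ x in box k n a, ENNReal.ofReal (w x) ∂volume) *
      (⨍⁻ x in box k n a, ENNReal.ofReal (w x) ^ (-1 / (p - 1)) ∂volume) ^ (p - 1)

/-- `w` is an `A_p`-weight on the domain: measurable, positive almost everywhere, with finite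
characteristic. (Finiteness forces `w` and `w ^ (-1/(p-1))` to be integrable over every box.)
Only the values of `w` on the domain matter. -/
structure IsApWeight {ι : Type*} [Fintype ι] (Ω : ι → Set ℝ) (k : ι → ℕ) (p : ℝ)
    (w : (ι → ℝ) → ℝ) : Prop where
  aemeasurable : AEMeasurable w (volume.restrict (domain Ω))
  pos : ∀ᵐ x ∂(volume.restrict (domain Ω)), 0 < w x
  finite : apConst Ω k p w < ∞

/-- The norm of `f` in `L_p(w dx)` over the domain, with value `∞` allowed. -/
def weightedNorm {ι : Type*} [Fintype ι] (Ω : ι → Set ℝ) (p : ℝ) (w : (ι → ℝ) → ℝ)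
    (f : (ι → ℝ) → ℝ) : ℝ≥0∞ :=
  (∫⁻ x in domain Ω, ‖f x‖ₑ ^ p * ENNReal.ofReal (w x)) ^ (1 / p)

/-- The `i`-th block of coordinates, for the partition of `{0, …, d-1}` into consecutive intervals
`[l i, l (i+1))`. -/
def block {d m : ℕ} (l : Fin (m + 1) → ℕ) (i : Fin m) : Finset (Fin d) :=
  Finset.univ.filter fun j => l i.castSucc ≤ (j : ℕ) ∧ (j : ℕ) < l i.succ

/-- The mixed norm of `f` over the first `i` blocks of variables, as a function of the remaining
ones: `F 0 = |f|` and
`F (i+1) = (∫ (F i) ^ p i * w i d(variables of block i)) ^ (1 / p i)`. It is written as a function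
of the whole point `x`, and does not depend on the coordinates already integrated out. -/
def partialMixedNorm {d m : ℕ} (Ω : Fin d → Set ℝ) (l : Fin (m + 1) → ℕ) (p : Fin m → ℝ)
    (w : (i : Fin m) → ((block (d := d) l i) → ℝ) → ℝ) (f : (Fin d → ℝ) → ℝ) :
    Fin (m + 1) → (Fin d → ℝ) → ℝ≥0∞ :=
  Fin.induction (motive := fun _ => (Fin d → ℝ) → ℝ≥0∞) (fun x => ‖f x‖ₑ)
    fun i F x =>
      (lmarginal (fun j => (volume : Measure ℝ).restrict (Ω j)) (block l i)
        (fun y => F y ^ p i * ENNReal.ofReal (w i ((block l i).restrict y))) x) ^ (1 / p i)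

/-- The norm of `f` in `L_{p_1,…,p_m}(w^1,…,w^m)`: all blocks are integrated out, so the base
point `0` plays no role. -/
def mixedNorm {d m : ℕ} (Ω : Fin d → Set ℝ) (l : Fin (m + 1) → ℕ) (p : Fin m → ℝ)
    (w : (i : Fin m) → ((block (d := d) l i) → ℝ) → ℝ) (f : (Fin d → ℝ) → ℝ) : ℝ≥0∞ :=
  partialMixedNorm Ω l p w f (Fin.last m) 0

end MixedExtrapolation

end

open MeasureTheory
open scoped ENNReal

namespace MixedExtrapolation

/-! The proof is Rubio de Francia extrapolation, carried out one block of variables at a time.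

Extrapolation from `p` to `q` for a doubling basis (`lpNormW_le_of_forall_weight`) treats all pairs
of exponents alike. Let W be an A_q weight, σ = W^(-1/(q-1)) its dual and q' = q/(q-1). By
Muckenhoupt's theorem (`HasAp.lintegral_maximal_rpow_mul_le`) the maximal operator is bounded on
L_q(W) and on L_q'(σ). The series ∑ b⁻ⁿ Mⁿ then majorizes G by an A_1 function H and a dual function
h by an A_1 function S, each with at most twice the norm. The weight V = H^(1-p) S is in A_p with
controlled constant (`hasAp_factorWeight`), so the estimate in L_p(V) is available. Hölder's
inequality turns it into ∫ U S ≤ N ∫ H S, and a second Hölder inequality bounds the right side by 4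
N ‖G‖ ‖h‖.

For mixed norms, suppose the norms over the earlier blocks satisfy a weighted estimate in all
remaining variables, for every weight of small enough characteristic. Extrapolate it to the exponent
p_i of the next block and apply it to the product of w^i and an arbitrary weight V in the later
variables; such a product is again an A_p weight (`BoxAp.mul_restrict`). Tonelli's theorem
integrates the block out and leaves the same kind of estimate with weight V
(`lpNormW_partialMixedNorm_castSucc`). When no variables remain, the estimate is the assertion.

The characteristic allowed at one stage is determined by the one needed at the next, so the
constants are built backwards from the last block (`exists_const_mixedNorm_le`). They involve the
boxes only through the doubling bound 4^(∑ k(j)), which is independent of the domain and of the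
partition; N₀ enters only as a factor in the final constant, never in the characteristic. -/

/-- A family of measurable sets of positive finite measure with a Vitali-type enlargement of
bounded measure ratio. -/
structure DoublingBasis {X : Type*} [MeasurableSpace X] (ν : Measure X) (I : Type*)
    (D : ℝ≥0∞) where
  carrier : I → Set X
  size : I → ℝ
  enlarge : I → I
  measurableSet : ∀ i, MeasurableSet (carrier i)
  size_nonneg : ∀ i, 0 ≤ size i
  measure_ne_zero : ∀ i, ν (carrier i) ≠ 0
  measure_ne_top : ∀ i, ν (carrier i) ≠ ∞
  subset_enlarge : ∀ i j, (carrier i ∩ carrier j).Nonempty → size i ≤ 3 / 2 * size j →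
    carrier i ⊆ carrier (enlarge j)
  measure_enlarge_le : ∀ i, ν (carrier (enlarge i)) ≤ D * ν (carrier i)

/-- The maximal function over the sets `C i` with respect to the measure `μ`. -/
noncomputable def maximal {X I : Type*} [MeasurableSpace X] (C : I → Set X) (μ : Measure X)
    (f : X → ℝ≥0∞) (x : X) : ℝ≥0∞ :=
  ⨆ i, (C i).indicator (fun _ => (∫⁻ y in C i, f y ∂μ) / μ (C i)) x

/-! ### Vitali covering and the maximal theorem for doubling measures -/

section Maximal

variable {X I : Type*} [MeasurableSpace X] {ν : Measure X} {D : ℝ≥0∞}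

theorem measurable_maximal [Countable I] {C : I → Set X} (hC : ∀ i, MeasurableSet (C i))
    (μ : Measure X) (f : X → ℝ≥0∞) : Measurable (maximal C μ f) :=
  Measurable.iSup fun i => measurable_const.indicator (hC i)

theorem average_le_maximal {C : I → Set X} (μ : Measure X) (f : X → ℝ≥0∞) {i : I} {x : X}
    (hx : x ∈ C i) : (∫⁻ y in C i, f y ∂μ) / μ (C i) ≤ maximal C μ f x := by
  refine le_trans ?_ (le_iSup _ i)
  rw [Set.indicator_of_mem hx]

theorem DoublingBasis.nonempty (𝓑 : DoublingBasis ν I D) (i : I) : (𝓑.carrier i).Nonempty :=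
  nonempty_of_measure_ne_zero (𝓑.measure_ne_zero i)

theorem DoublingBasis.subset_enlarge_self (𝓑 : DoublingBasis ν I D) (i : I) :
    𝓑.carrier i ⊆ 𝓑.carrier (𝓑.enlarge i) := by
  refine 𝓑.subset_enlarge i i (by simpa using 𝓑.nonempty i) ?_
  linarith [𝓑.size_nonneg i]

/-- Vitali covering estimate for finitely many sets of the basis. -/
theorem DoublingBasis.measure_biUnion_le (𝓑 : DoublingBasis ν I D) {μ : Measure X} {A : ℝ≥0∞}
    (hA : ∀ i, μ (𝓑.carrier (𝓑.enlarge i)) ≤ A * μ (𝓑.carrier i)) (t : Finset I)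
    {φ : X → ℝ≥0∞} (ht : ∀ i ∈ t, μ (𝓑.carrier i) ≤ ∫⁻ x in 𝓑.carrier i, φ x ∂μ) :
    μ (⋃ i ∈ t, 𝓑.carrier i) ≤ A * ∫⁻ x, φ x ∂μ := by
  classical
  -- The Vitali selection needs bounded sizes, which is why finite families come first.
  obtain ⟨R, hR⟩ := (t.finite_toSet.image 𝓑.size).bddAbove
  obtain ⟨u, hut, hdis, hcov⟩ := Vitali.exists_disjoint_subfamily_covering_enlargement
    𝓑.carrier (t : Set I) 𝓑.size (3 / 2) (by norm_num) (fun a _ => 𝓑.size_nonneg a) R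
    (fun a ha => hR (Set.mem_image_of_mem _ ha)) (fun a _ => 𝓑.nonempty a)
  have hufin : u.Finite := t.finite_toSet.subset hut
  obtain ⟨v, rfl⟩ := hufin.exists_finset_coe
  have hsub : (⋃ i ∈ t, 𝓑.carrier i) ⊆ ⋃ i ∈ v, 𝓑.carrier (𝓑.enlarge i) := by
    refine Set.iUnion₂_subset fun i hi => ?_
    obtain ⟨b, hb, hne, hsz⟩ := hcov i hi
    exact (𝓑.subset_enlarge i b hne hsz).trans
      (Set.subset_biUnion_of_mem (u := fun i => 𝓑.carrier (𝓑.enlarge i)) hb)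
  calc μ (⋃ i ∈ t, 𝓑.carrier i) ≤ μ (⋃ i ∈ v, 𝓑.carrier (𝓑.enlarge i)) := measure_mono hsub
    _ ≤ ∑ i ∈ v, μ (𝓑.carrier (𝓑.enlarge i)) := measure_biUnion_finset_le _ _
    _ ≤ ∑ i ∈ v, A * ∫⁻ x in 𝓑.carrier i, φ x ∂μ :=
        Finset.sum_le_sum fun i hi => (hA i).trans (by gcongr; exact ht i (hut hi))
    _ = A * ∫⁻ x in ⋃ i ∈ v, 𝓑.carrier i, φ x ∂μ := by
        rw [← Finset.mul_sum, lintegral_biUnion_finset hdis (fun i _ => 𝓑.measurableSet i)]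
    _ ≤ A * ∫⁻ x, φ x ∂μ := by gcongr; exact Measure.restrict_le_self

/-- A countable union is the increasing limit of finite ones, and the finite bound does not depend
on the number or the sizes of the sets. -/
theorem DoublingBasis.measure_iUnion_le [Countable I] (𝓑 : DoublingBasis ν I D) {μ : Measure X}
    {A : ℝ≥0∞} (hA : ∀ i, μ (𝓑.carrier (𝓑.enlarge i)) ≤ A * μ (𝓑.carrier i)) (s : Set I)
    {φ : X → ℝ≥0∞} (hs : ∀ i ∈ s, μ (𝓑.carrier i) ≤ ∫⁻ x in 𝓑.carrier i, φ x ∂μ) :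
    μ (⋃ i ∈ s, 𝓑.carrier i) ≤ A * ∫⁻ x, φ x ∂μ := by
  classical
  rw [Set.biUnion_eq_iUnion, Set.iUnion_eq_iUnion_finset, Directed.measure_iUnion]
  · refine iSup_le fun t => ?_
    refine le_trans (measure_mono ?_)
      (𝓑.measure_biUnion_le hA (t.image Subtype.val) (φ := φ) ?_)
    · intro x hx
      simp only [Set.mem_iUnion] at hx ⊢
      obtain ⟨i, hi, hx⟩ := hx
      exact ⟨i, Finset.mem_image_of_mem _ hi, hx⟩
    · intro i hi
      obtain ⟨j, -, rfl⟩ := Finset.mem_image.1 hi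
      exact hs j j.2
  · exact directed_of_isDirected_le fun _ _ hsub =>
      Set.biUnion_subset_biUnion_left hsub

/-- Weak-type estimate for the maximal function, localized to large values of `f`. -/
theorem DoublingBasis.measure_lt_maximal_le [Countable I] (𝓑 : DoublingBasis ν I D)
    {μ : Measure X} {A : ℝ≥0∞} (h0 : ∀ i, μ (𝓑.carrier i) ≠ 0)
    (htop : ∀ i, μ (𝓑.carrier i) ≠ ∞)
    (hA : ∀ i, μ (𝓑.carrier (𝓑.enlarge i)) ≤ A * μ (𝓑.carrier i))
    {f : X → ℝ≥0∞} (hf : Measurable f) {t : ℝ≥0∞} (ht0 : t ≠ 0) (ht : t ≠ ∞) :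
    μ {x | t < maximal 𝓑.carrier μ f x} ≤
      A * ∫⁻ x, 2 / t * {x | t < 2 * f x}.indicator f x ∂μ := by
  set s : Set I := {i | t < (∫⁻ y in 𝓑.carrier i, f y ∂μ) / μ (𝓑.carrier i)}
  have hE : MeasurableSet {x | t < 2 * f x} := measurableSet_lt measurable_const (hf.const_mul 2)
  refine (measure_mono ?_).trans (𝓑.measure_iUnion_le hA s ?_)
  · intro x hx
    obtain ⟨i, hi⟩ := lt_iSup_iff.1 (show t < ⨆ i, _ from hx)
    by_cases hxi : x ∈ 𝓑.carrier i
    · rw [Set.indicator_of_mem hxi] at hi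
      exact Set.mem_biUnion (show i ∈ s from hi) hxi
    · simp [hxi] at hi
  · intro i hi
    set C := 𝓑.carrier i
    have h1 : t * μ C ≤ ∫⁻ y in C, f y ∂μ :=
      ((ENNReal.lt_div_iff_mul_lt (.inl (h0 i)) (.inl (htop i))).1 hi).le
    -- Where `2 * f ≤ t`, the function contributes at most `t / 2 * μ C`. That is half of the lower
    -- bound in `h1` and is finite, so it can be subtracted.
    have h2 : ∫⁻ y in C, f y ∂μ ≤
        (∫⁻ y in C, {x | t < 2 * f x}.indicator f y ∂μ) + t / 2 * μ C := by
      rw [← setLIntegral_const, ← lintegral_add_right _ measurable_const]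
      refine lintegral_mono fun y => ?_
      by_cases hy : t < 2 * f y
      · rw [Set.indicator_of_mem (show y ∈ {x | t < 2 * f x} from hy)]
        exact le_self_add
      · refine le_trans ?_ le_add_self
        rw [ENNReal.le_div_iff_mul_le (by simp) (by simp), mul_comm]
        exact not_lt.1 hy
    have h3 : t / 2 * μ C ≤ ∫⁻ y in C, {x | t < 2 * f x}.indicator f y ∂μ := by
      have : t / 2 * μ C + t / 2 * μ C ≤
          (∫⁻ y in C, {x | t < 2 * f x}.indicator f y ∂μ) + t / 2 * μ C := by
        rw [← add_mul, ENNReal.add_halves]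
        exact h1.trans h2
      exact (ENNReal.add_le_add_iff_right
        (ENNReal.mul_ne_top (ENNReal.div_ne_top ht (by simp)) (htop i))).1 this
    rw [lintegral_const_mul _ (hf.indicator hE)]
    calc μ C = 2 / t * (t / 2 * μ C) := by
          rw [← mul_assoc, ← mul_div_assoc, ENNReal.div_mul_cancel ht0 ht,
            ENNReal.div_self (by simp) (by simp), one_mul]
      _ ≤ _ := by gcongr

theorem setLIntegral_Ioo_rpow {s a : ℝ} (hs : 0 < s) (ha : 0 ≤ a) :
    ∫⁻ t in Set.Ioo 0 a, ENNReal.ofReal (s * t ^ (s - 1)) = ENNReal.ofReal (a ^ s) := by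
  rw [restrict_Ioo_eq_restrict_Ioc]
  have hint : IntervalIntegrable (fun t : ℝ => s * t ^ (s - 1)) volume 0 a :=
    (intervalIntegral.intervalIntegrable_rpow' (by linarith)).const_mul s
  rw [← ofReal_integral_eq_lintegral_ofReal, ← intervalIntegral.integral_of_le ha]
  · rw [intervalIntegral.integral_const_mul, integral_rpow (.inl (by linarith))]
    congr 1
    rw [sub_add_cancel, Real.zero_rpow hs.ne', sub_zero]
    field_simp
  · exact (intervalIntegrable_iff_integrableOn_Ioc_of_le ha).1 hint
  · filter_upwards [ae_restrict_mem measurableSet_Ioc] with t ht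
    exact mul_nonneg hs.le (Real.rpow_nonneg ht.1.le _)

/-- Layer-cake formula for a power. -/
theorem rpow_eq_lintegral_indicator {s : ℝ} (hs : 0 < s) (y : ℝ≥0∞) :
    y ^ s = ∫⁻ t in Set.Ioi (0 : ℝ),
      {t : ℝ | ENNReal.ofReal t < y}.indicator (fun t => ENNReal.ofReal (s * t ^ (s - 1))) t := by
  have hm : ∀ y : ℝ≥0∞, MeasurableSet {t : ℝ | ENNReal.ofReal t < y} := fun y =>
    measurableSet_lt ENNReal.measurable_ofReal measurable_const
  have key : ∀ a : ℝ, 0 ≤ a → ∫⁻ t in Set.Ioi (0 : ℝ), {t : ℝ | ENNReal.ofReal t <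
      ENNReal.ofReal a}.indicator (fun t => ENNReal.ofReal (s * t ^ (s - 1))) t =
      ENNReal.ofReal (a ^ s) := by
    intro a ha
    rw [setLIntegral_indicator (hm _), ← setLIntegral_Ioo_rpow hs ha]
    congr 2
    ext t
    simp only [Set.mem_inter_iff, Set.mem_ofPred_eq, Set.mem_Ioi, Set.mem_Ioo]
    constructor
    · rintro ⟨h1, h2⟩
      exact ⟨h2, (ENNReal.ofReal_lt_ofReal_iff_of_nonneg h2.le).1 h1⟩
    · rintro ⟨h1, h2⟩
      exact ⟨(ENNReal.ofReal_lt_ofReal_iff_of_nonneg h1.le).2 h2, h1⟩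
  rcases eq_or_ne y ∞ with rfl | hy
  · rw [ENNReal.top_rpow_of_pos hs]
    refine (ENNReal.eq_top_of_forall_nnreal_le fun r => ?_).symm
    have hr : (r : ℝ≥0∞) = ENNReal.ofReal (((r : ℝ) ^ (1 / s)) ^ s) := by
      rw [← Real.rpow_mul r.coe_nonneg, one_div, inv_mul_cancel₀ hs.ne', Real.rpow_one,
        ENNReal.ofReal_coe_nnreal]
    rw [hr, ← key _ (Real.rpow_nonneg r.coe_nonneg _)]
    refine lintegral_mono fun t => Set.indicator_le_indicator_of_subset ?_ (by simp) t
    intro t _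
    exact ENNReal.ofReal_lt_top
  · lift y to NNReal using hy
    rw [← ENNReal.ofReal_coe_nnreal, key _ y.coe_nonneg,
      ENNReal.ofReal_rpow_of_nonneg y.coe_nonneg hs.le]

/-- Strong-type estimate for the maximal function with respect to a doubling measure. -/
theorem DoublingBasis.lintegral_maximal_rpow_le [Countable I] (𝓑 : DoublingBasis ν I D)
    {μ : Measure X} [SFinite μ] {A : ℝ≥0∞} (h0 : ∀ i, μ (𝓑.carrier i) ≠ 0)
    (htop : ∀ i, μ (𝓑.carrier i) ≠ ∞)
    (hA : ∀ i, μ (𝓑.carrier (𝓑.enlarge i)) ≤ A * μ (𝓑.carrier i))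
    {f : X → ℝ≥0∞} (hf : Measurable f) {r : ℝ} (hr : 1 < r) :
    ∫⁻ x, maximal 𝓑.carrier μ f x ^ r ∂μ ≤
      A * ENNReal.ofReal (2 ^ r * r / (r - 1)) * ∫⁻ x, f x ^ r ∂μ := by
  have hM := measurable_maximal 𝓑.measurableSet μ f
  have hpow : ∀ s : ℝ, Measurable fun t : ℝ => ENNReal.ofReal (s * t ^ (s - 1)) := fun s => by
    fun_prop
  have hjoint : ∀ {g : X → ℝ≥0∞} (s : ℝ), Measurable g → Measurable fun q : X × ℝ =>
      {t : ℝ | ENNReal.ofReal t < g q.1}.indicator (fun t => ENNReal.ofReal (s * t ^ (s - 1)))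
        q.2 := by
    intro g s hg
    exact ((hpow s).comp measurable_snd).indicator
      (measurableSet_lt (ENNReal.measurable_ofReal.comp measurable_snd) (hg.comp measurable_fst))
  have hr1 : 0 < r - 1 := by linarith
  set c : ℝ≥0∞ := ENNReal.ofReal (2 * r / (r - 1))
  have hlevel : ∀ t : ℝ, 0 < t →
      ∫⁻ x, {t : ℝ | ENNReal.ofReal t < maximal 𝓑.carrier μ f x}.indicator
        (fun t => ENNReal.ofReal (r * t ^ (r - 1))) t ∂μ ≤
      A * ∫⁻ x, c * f x * {t : ℝ | ENNReal.ofReal t < 2 * f x}.indicator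
        (fun t => ENNReal.ofReal ((r - 1) * t ^ (r - 1 - 1))) t ∂μ := by
    intro t ht
    have ht' : ENNReal.ofReal t ≠ 0 := by simpa using ht
    have hset : MeasurableSet {x | ENNReal.ofReal t < maximal 𝓑.carrier μ f x} :=
      measurableSet_lt measurable_const hM
    have hmeas : Measurable fun x =>
        2 / ENNReal.ofReal t * {x | ENNReal.ofReal t < 2 * f x}.indicator f x :=
      (hf.indicator (measurableSet_lt measurable_const (hf.const_mul 2))).const_mul _
    -- The factor `2 / t` of the weak-type bound lowers the power of `t` by one; `c` is the constant
    -- that leaves exactly the layer-cake density of exponent `r - 1`.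
    have hc : ENNReal.ofReal (r * t ^ (r - 1)) * (2 / ENNReal.ofReal t) =
        c * ENNReal.ofReal ((r - 1) * t ^ (r - 1 - 1)) := by
      rw [show (2 : ℝ≥0∞) = ENNReal.ofReal 2 by simp, ← ENNReal.ofReal_div_of_pos ht,
        ← ENNReal.ofReal_mul (by positivity), ← ENNReal.ofReal_mul (by positivity)]
      congr 1
      rw [Real.rpow_sub_one ht.ne' (r - 1)]
      field_simp
    calc ∫⁻ x, {t : ℝ | ENNReal.ofReal t < maximal 𝓑.carrier μ f x}.indicator
          (fun t => ENNReal.ofReal (r * t ^ (r - 1))) t ∂μ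
        = ∫⁻ x, {x | ENNReal.ofReal t < maximal 𝓑.carrier μ f x}.indicator
          (fun _ => ENNReal.ofReal (r * t ^ (r - 1))) x ∂μ := rfl
      _ = ENNReal.ofReal (r * t ^ (r - 1)) *
          μ {x | ENNReal.ofReal t < maximal 𝓑.carrier μ f x} := by
          rw [lintegral_indicator_const hset]
      _ ≤ ENNReal.ofReal (r * t ^ (r - 1)) * (A * ∫⁻ x, 2 / ENNReal.ofReal t *
          {x | ENNReal.ofReal t < 2 * f x}.indicator f x ∂μ) := by
          gcongr
          exact 𝓑.measure_lt_maximal_le h0 htop hA hf ht' ENNReal.ofReal_ne_top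
      _ = _ := by
          rw [mul_left_comm, ← lintegral_const_mul _ hmeas]
          congr 1
          refine lintegral_congr fun x => ?_
          by_cases hx : ENNReal.ofReal t < 2 * f x
          · rw [Set.indicator_of_mem (show x ∈ {x | ENNReal.ofReal t < 2 * f x} from hx),
              Set.indicator_of_mem (show t ∈ {t : ℝ | ENNReal.ofReal t < 2 * f x} from hx),
              ← mul_assoc, hc]
            ring
          · rw [Set.indicator_of_notMem (show x ∉ {x | ENNReal.ofReal t < 2 * f x} from hx),
              Set.indicator_of_notMem (show t ∉ {t : ℝ | ENNReal.ofReal t < 2 * f x} from hx)]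
            simp
  have hjoint2 : Measurable fun q : X × ℝ => c * f q.1 *
      {t : ℝ | ENNReal.ofReal t < 2 * f q.1}.indicator
        (fun t => ENNReal.ofReal ((r - 1) * t ^ (r - 1 - 1))) q.2 :=
    ((hf.comp measurable_fst).const_mul c).mul (hjoint (g := fun x => 2 * f x) _ (hf.const_mul 2))
  calc ∫⁻ x, maximal 𝓑.carrier μ f x ^ r ∂μ
      = ∫⁻ x, (∫⁻ t in Set.Ioi (0 : ℝ), {t : ℝ | ENNReal.ofReal t <
          maximal 𝓑.carrier μ f x}.indicator (fun t => ENNReal.ofReal (r * t ^ (r - 1))) t) ∂μ :=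
        lintegral_congr fun x => rpow_eq_lintegral_indicator (by linarith) _
    _ = ∫⁻ t in Set.Ioi (0 : ℝ), ∫⁻ x, {t : ℝ | ENNReal.ofReal t <
          maximal 𝓑.carrier μ f x}.indicator (fun t => ENNReal.ofReal (r * t ^ (r - 1))) t ∂μ :=
        lintegral_lintegral_swap (hjoint r hM).aemeasurable
    _ ≤ ∫⁻ t in Set.Ioi (0 : ℝ), A * ∫⁻ x, c * f x * {t : ℝ | ENNReal.ofReal t < 2 * f x}.indicator
          (fun t => ENNReal.ofReal ((r - 1) * t ^ (r - 1 - 1))) t ∂μ :=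
        setLIntegral_mono' measurableSet_Ioi fun t ht => hlevel t ht
    _ = A * ∫⁻ t in Set.Ioi (0 : ℝ), ∫⁻ x, c * f x * {t : ℝ | ENNReal.ofReal t <
          2 * f x}.indicator (fun t => ENNReal.ofReal ((r - 1) * t ^ (r - 1 - 1))) t ∂μ :=
        lintegral_const_mul _ hjoint2.lintegral_prod_left'
    _ = A * ∫⁻ x, (∫⁻ t in Set.Ioi (0 : ℝ), c * f x * {t : ℝ | ENNReal.ofReal t <
          2 * f x}.indicator (fun t => ENNReal.ofReal ((r - 1) * t ^ (r - 1 - 1))) t) ∂μ := by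
        congr 1
        exact (lintegral_lintegral_swap hjoint2.aemeasurable).symm
    _ = A * ∫⁻ x, ENNReal.ofReal (2 ^ r * r / (r - 1)) * f x ^ r ∂μ := by
        congr 1
        refine lintegral_congr fun x => ?_
        rw [lintegral_const_mul _ ((hpow _).indicator
          (measurableSet_lt ENNReal.measurable_ofReal measurable_const)),
          ← rpow_eq_lintegral_indicator hr1, ENNReal.mul_rpow_of_nonneg _ _ hr1.le]
        have h2 : c * 2 ^ (r - 1) = ENNReal.ofReal (2 ^ r * r / (r - 1)) := by
          rw [show (2 : ℝ≥0∞) = ENNReal.ofReal 2 by simp,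
            ENNReal.ofReal_rpow_of_pos two_pos, ← ENNReal.ofReal_mul (by positivity)]
          congr 1
          rw [Real.rpow_sub_one two_ne_zero]
          field_simp
        have h3 : f x * f x ^ (r - 1) = f x ^ r := by
          nth_rw 1 [← ENNReal.rpow_one (f x)]
          rw [← ENNReal.rpow_add_of_nonneg _ _ zero_le_one hr1.le]
          congr 1
          ring
        rw [mul_mul_mul_comm, h2, h3]
    _ = _ := by rw [lintegral_const_mul _ (hf.pow_const r), mul_assoc]

end Maximal

/-! ### Muckenhoupt weights and Muckenhoupt's theorem -/

/-- A measurable extended nonnegative function with values in `(0, ∞)`. -/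
structure IsPosWeight {X : Type*} [MeasurableSpace X] (W : X → ℝ≥0∞) : Prop where
  measurable : Measurable W
  ne_zero : ∀ x, W x ≠ 0
  ne_top : ∀ x, W x ≠ ∞

theorem IsPosWeight.rpow {X : Type*} [MeasurableSpace X] {W : X → ℝ≥0∞} (hW : IsPosWeight W)
    (r : ℝ) : IsPosWeight fun x => W x ^ r :=
  ⟨hW.measurable.pow_const r, fun x => (ENNReal.rpow_pos (hW.ne_zero x).bot_lt (hW.ne_top x)).ne',
    fun x => ENNReal.rpow_ne_top_of_ne_zero (hW.ne_zero x) (hW.ne_top x)⟩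

/-- The `A_p` condition for `W` on the sets `C i`, with constant `K`. -/
def HasAp {X I : Type*} [MeasurableSpace X] (C : I → Set X) (ν : Measure X) (p : ℝ)
    (W : X → ℝ≥0∞) (K : ℝ≥0∞) : Prop :=
  ∀ i, (∫⁻ x in C i, W x ∂ν) * (∫⁻ x in C i, W x ^ (-1 / (p - 1)) ∂ν) ^ (p - 1) ≤ K * ν (C i) ^ p

section Muckenhoupt

variable {X I : Type*} [MeasurableSpace X] {ν : Measure X} {D K : ℝ≥0∞} {C : I → Set X} {p : ℝ}
  {W : X → ℝ≥0∞}

theorem conj_sub_one (hp : 1 < p) : p / (p - 1) - 1 = 1 / (p - 1) := by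
  have : p - 1 ≠ 0 := by linarith
  field_simp
  ring

theorem holderConjugate_conj (hp : 1 < p) : p.HolderConjugate (p / (p - 1)) :=
  Real.HolderConjugate.conjExponent hp

theorem one_lt_conj (hp : 1 < p) : 1 < p / (p - 1) := (holderConjugate_conj hp).symm.lt

theorem rpow_dual_dual (hp : 1 < p) (y : ℝ≥0∞) :
    (y ^ (-1 / (p - 1))) ^ (-1 / (p / (p - 1) - 1)) = y := by
  have : p - 1 ≠ 0 := by linarith
  rw [← ENNReal.rpow_mul, conj_sub_one hp, show -1 / (p - 1) * (-1 / (1 / (p - 1))) = 1 by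
    field_simp, ENNReal.rpow_one]

/-- Raising the condition to the power 1/(p-1) = p' - 1, where p' = p/(p-1), exchanges the roles of
the two integrals. -/
theorem HasAp.dual (hp : 1 < p) (h : HasAp C ν p W K) :
    HasAp C ν (p / (p - 1)) (fun x => W x ^ (-1 / (p - 1))) (K ^ (1 / (p - 1))) := by
  intro i
  have hp1 : 0 < p - 1 := by linarith
  simp_rw [rpow_dual_dual hp]
  have := ENNReal.rpow_le_rpow (h i) (z := 1 / (p - 1)) (by positivity)
  rw [ENNReal.mul_rpow_of_nonneg _ _ (by positivity),
    ENNReal.mul_rpow_of_nonneg _ _ (by positivity),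
    ← ENNReal.rpow_mul, ← ENNReal.rpow_mul, mul_one_div_cancel hp1.ne', ENNReal.rpow_one,
    mul_one_div] at this
  rwa [mul_comm, conj_sub_one hp]

theorem setLIntegral_ne_zero_of_posWeight (hW : IsPosWeight W) {s : Set X} (hs : ν s ≠ 0) :
    ∫⁻ x in s, W x ∂ν ≠ 0 := by
  intro h
  rw [lintegral_eq_zero_iff hW.measurable] at h
  have h2 : ∀ᵐ x ∂ν.restrict s, False := h.mono fun x hx => hW.ne_zero x hx
  rw [ae_iff] at h2
  simp [hs] at h2

/-- The dual factor is nonzero because the weight is positive, so an infinite integral of `W` would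
make the left side of the A_p condition infinite. -/
theorem HasAp.setLIntegral_ne_top (hp : 1 < p) (hW : IsPosWeight W) (hK : K ≠ ∞)
    (h : HasAp C ν p W K) {i : I} (h0 : ν (C i) ≠ 0) (ht : ν (C i) ≠ ∞) :
    ∫⁻ x in C i, W x ∂ν ≠ ∞ := by
  intro htop
  have h1 := h i
  have hz : (∫⁻ x in C i, W x ^ (-1 / (p - 1)) ∂ν) ^ (p - 1) ≠ 0 := by
    rw [Ne, ENNReal.rpow_eq_zero_iff_of_pos (by linarith)]
    exact setLIntegral_ne_zero_of_posWeight (hW.rpow _) h0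
  rw [htop, ENNReal.top_mul hz, top_le_iff] at h1
  exact ENNReal.mul_ne_top hK (ENNReal.rpow_ne_top_of_nonneg (by linarith) ht) h1

/-- Hölder's inequality for 1 = W^(1/p) · W^(-1/p): the reverse of the A_p condition, valid for
every weight. -/
theorem measure_rpow_le_mul (hp : 1 < p) (hW : IsPosWeight W) (s : Set X) :
    ν s ^ p ≤ (∫⁻ x in s, W x ∂ν) * (∫⁻ x in s, W x ^ (-1 / (p - 1)) ∂ν) ^ (p - 1) := by
  have hp0 : 0 < p := by linarith
  have hp1 : 0 < p - 1 := by linarith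
  have h := ENNReal.lintegral_mul_le_Lp_mul_Lq (ν.restrict s) (holderConjugate_conj hp)
    (f := fun x => W x ^ (1 / p)) (g := fun x => W x ^ (-(1 / p)))
    (hW.measurable.pow_const _).aemeasurable (hW.measurable.pow_const _).aemeasurable
  have h1 : ∀ x, ((fun x => W x ^ (1 / p)) * fun x => W x ^ (-(1 / p))) x = 1 := fun x => by
    simp only [Pi.mul_apply]
    rw [← ENNReal.rpow_add _ _ (hW.ne_zero x) (hW.ne_top x)]
    simp
  simp_rw [h1, ← ENNReal.rpow_mul] at h
  rw [lintegral_one, Measure.restrict_apply_univ] at h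
  have h2 := ENNReal.rpow_le_rpow h hp0.le
  rw [ENNReal.mul_rpow_of_nonneg _ _ hp0.le, ← ENNReal.rpow_mul, ← ENNReal.rpow_mul] at h2
  convert h2 using 2
  · rw [one_div_mul_cancel hp0.ne', ENNReal.rpow_one]
    simp
  · congr 1
    · refine lintegral_congr fun x => ?_
      congr 1
      field_simp
    · field_simp

/-- The measure W dν inherits doubling. Use A_p on the enlarged set, compare the ν-measures, apply
`measure_rpow_le_mul` on the original set, and cancel the dual integral, which only grows under
enlargement. -/
theorem HasAp.enlarge_le (𝓑 : DoublingBasis ν I D) (hp : 1 < p) (hW : IsPosWeight W) (hK : K ≠ ∞)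
    (h : HasAp 𝓑.carrier ν p W K) (i : I) :
    ∫⁻ x in 𝓑.carrier (𝓑.enlarge i), W x ∂ν ≤ K * D ^ p * ∫⁻ x in 𝓑.carrier i, W x ∂ν := by
  have hp1 : 0 < p - 1 := by linarith
  set j := 𝓑.enlarge i
  set s := (∫⁻ x in 𝓑.carrier j, W x ^ (-1 / (p - 1)) ∂ν) ^ (p - 1) with hs
  have hconj := one_lt_conj hp
  have hs0 : s ≠ 0 := by
    rw [hs, Ne, ENNReal.rpow_eq_zero_iff_of_pos hp1]
    exact setLIntegral_ne_zero_of_posWeight (hW.rpow _) (𝓑.measure_ne_zero j)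
  have hst : s ≠ ∞ := by
    refine ENNReal.rpow_ne_top_of_nonneg hp1.le ?_
    exact (h.dual hp).setLIntegral_ne_top hconj (hW.rpow _)
      (ENNReal.rpow_ne_top_of_nonneg (by positivity) hK) (𝓑.measure_ne_zero j)
      (𝓑.measure_ne_top j)
  rw [← ENNReal.mul_le_mul_iff_left hs0 hst]
  calc (∫⁻ x in 𝓑.carrier j, W x ∂ν) * s ≤ K * ν (𝓑.carrier j) ^ p := h j
    _ ≤ K * (D * ν (𝓑.carrier i)) ^ p := by
        gcongr
        exact 𝓑.measure_enlarge_le i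
    _ = K * D ^ p * ν (𝓑.carrier i) ^ p := by
        rw [ENNReal.mul_rpow_of_nonneg _ _ (by linarith), mul_assoc]
    _ ≤ K * D ^ p * ((∫⁻ x in 𝓑.carrier i, W x ∂ν) *
          (∫⁻ x in 𝓑.carrier i, W x ^ (-1 / (p - 1)) ∂ν) ^ (p - 1)) := by
        gcongr
        exact measure_rpow_le_mul hp hW _
    _ ≤ K * D ^ p * ((∫⁻ x in 𝓑.carrier i, W x ∂ν) * s) := by
        gcongr
        rw [hs]
        gcongr
        exact 𝓑.subset_enlarge_self i
    _ = _ := by rw [mul_assoc, mul_assoc, mul_assoc]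

/-- Strong-type estimate for the maximal function with respect to the measure `W dν`. -/
theorem HasAp.lintegral_maximal_withDensity_le [Countable I] [SFinite ν] (𝓑 : DoublingBasis ν I D)
    (hp : 1 < p) (hW : IsPosWeight W) (hK : K ≠ ∞) (h : HasAp 𝓑.carrier ν p W K)
    {f : X → ℝ≥0∞} (hf : Measurable f) {r : ℝ} (hr : 1 < r) :
    ∫⁻ x, W x * maximal 𝓑.carrier (ν.withDensity W) f x ^ r ∂ν ≤
      K * D ^ p * ENNReal.ofReal (2 ^ r * r / (r - 1)) * ∫⁻ x, W x * f x ^ r ∂ν := by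
  have hap : ∀ i, ν.withDensity W (𝓑.carrier i) = ∫⁻ x in 𝓑.carrier i, W x ∂ν := fun i =>
    withDensity_apply _ (𝓑.measurableSet i)
  have := 𝓑.lintegral_maximal_rpow_le (μ := ν.withDensity W) (A := K * D ^ p)
    (fun i => by
      rw [hap]
      exact setLIntegral_ne_zero_of_posWeight hW (𝓑.measure_ne_zero i))
    (fun i => by
      rw [hap]
      exact h.setLIntegral_ne_top hp hW hK (𝓑.measure_ne_zero i) (𝓑.measure_ne_top i))
    (fun i => by
      rw [hap, hap]
      exact h.enlarge_le 𝓑 hp hW hK i) hf hr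
  rwa [lintegral_withDensity_eq_lintegral_mul _ hW.measurable
    ((measurable_maximal 𝓑.measurableSet _ _).pow_const r),
    lintegral_withDensity_eq_lintegral_mul _ hW.measurable (hf.pow_const r)] at this

/-- The bound of the maximal operator on `L_p(W)` given by `lintegral_maximal_rpow_mul_le`. -/
noncomputable def maximalConst (p : ℝ) (D K : ℝ≥0∞) : ℝ≥0∞ :=
  K ^ (p / (p - 1)) * (K * D ^ p * ENNReal.ofReal (2 ^ (p / (p - 1)) * (p / (p - 1)) /
    (p / (p - 1) - 1)) * (K ^ (1 / (p - 1)) * D ^ (p / (p - 1)) *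
      ENNReal.ofReal (2 ^ p * p / (p - 1))))

theorem maximalConst_ne_top (hp : 1 < p) (hD : D ≠ ∞) (hK : K ≠ ∞) : maximalConst p D K ≠ ∞ := by
  have hp1 : 0 < p - 1 := by linarith
  have h1 : 0 ≤ p / (p - 1) := by positivity
  have h2 : 0 ≤ 1 / (p - 1) := by positivity
  have h3 : 0 ≤ p := by linarith
  unfold maximalConst
  finiteness

/-- Pointwise domination of the maximal function by weighted maximal functions. -/
theorem maximal_rpow_le (𝓑 : DoublingBasis ν I D) [Countable I] (hp : 1 < p)
    (hW : IsPosWeight W) (hK : K ≠ ∞) (h : HasAp 𝓑.carrier ν p W K) {f : X → ℝ≥0∞}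
    (hf : Measurable f) (x : X) :
    maximal 𝓑.carrier ν f x ^ (p - 1) ≤ K * maximal 𝓑.carrier (ν.withDensity W)
      (fun y => maximal 𝓑.carrier (ν.withDensity fun z => W z ^ (-1 / (p - 1)))
        (fun z => f z / W z ^ (-1 / (p - 1))) y ^ (p - 1) / W y) x := by
  have hp1 : 0 < p - 1 := by linarith
  set σ : X → ℝ≥0∞ := fun z => W z ^ (-1 / (p - 1)) with hσdef
  have hσ : IsPosWeight σ := hW.rpow _
  set m := maximal 𝓑.carrier (ν.withDensity σ) (fun z => f z / σ z) with hm
  have hmm : Measurable m := measurable_maximal 𝓑.measurableSet _ _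
  set n := maximal 𝓑.carrier (ν.withDensity W) (fun y => m y ^ (p - 1) / W y) with hn
  rw [ENNReal.le_rpow_inv_iff hp1 |>.symm]
  refine iSup_le fun i => ?_
  by_cases hx : x ∈ 𝓑.carrier i
  swap
  · simp [hx]
  rw [Set.indicator_of_mem hx, ENNReal.le_rpow_inv_iff hp1]
  set C := 𝓑.carrier i with hC
  have hCm : MeasurableSet C := 𝓑.measurableSet i
  have hν0 : ν C ≠ 0 := 𝓑.measure_ne_zero i
  have hνt : ν C ≠ ∞ := 𝓑.measure_ne_top i
  set w := ∫⁻ y in C, W y ∂ν with hw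
  set s := ∫⁻ y in C, σ y ∂ν with hs
  set F := ∫⁻ y in C, f y ∂ν with hF
  have hw0 : w ≠ 0 := setLIntegral_ne_zero_of_posWeight hW hν0
  have hs0 : s ≠ 0 := setLIntegral_ne_zero_of_posWeight hσ hν0
  have hwt : w ≠ ∞ := h.setLIntegral_ne_top hp hW hK hν0 hνt
  have hst : s ≠ ∞ := (h.dual hp).setLIntegral_ne_top (one_lt_conj hp) hσ
      (ENNReal.rpow_ne_top_of_nonneg (by positivity) hK) hν0 hνt
  have hint : ∀ {V g : X → ℝ≥0∞}, IsPosWeight V → Measurable g →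
      ∫⁻ y in C, g y / V y ∂(ν.withDensity V) = ∫⁻ y in C, g y ∂ν := by
    intro V g hV hg
    refine (setLIntegral_withDensity_eq_setLIntegral_mul _ hV.measurable
      (hg.div hV.measurable) hCm).trans (lintegral_congr fun y => ?_)
    exact ENNReal.mul_div_cancel (hV.ne_zero y) (hV.ne_top y)
  -- `F / s` is the average of `f / σ` over `C` for the measure σ dν, so `m` dominates it on all of
  -- `C`. Averaging `m ^ (p - 1) / W` for W dν then gives `h2`; the A_p condition is needed only to
  -- replace `w * s ^ (p - 1)` at the end.
  have h1 : ∀ y ∈ C, F / s ≤ m y := by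
    intro y hy
    have := average_le_maximal (C := 𝓑.carrier) (ν.withDensity σ) (fun z => f z / σ z) hy
    rwa [withDensity_apply _ hCm, ← hC, hint hσ hf] at this
  have h2 : (F / s) ^ (p - 1) * ν C ≤ w * n x := by
    calc (F / s) ^ (p - 1) * ν C = ∫⁻ _ in C, (F / s) ^ (p - 1) ∂ν := by rw [setLIntegral_const]
      _ ≤ ∫⁻ y in C, m y ^ (p - 1) ∂ν :=
          setLIntegral_mono' hCm fun y hy => ENNReal.rpow_le_rpow (h1 y hy) hp1.le
      _ ≤ w * n x := by
          have := average_le_maximal (C := 𝓑.carrier) (ν.withDensity W)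
            (fun y => m y ^ (p - 1) / W y) hx
          rw [withDensity_apply _ hCm, ← hC, hint hW (hmm.pow_const _)] at this
          rw [mul_comm]
          exact (ENNReal.div_le_iff hw0 hwt).1 this
  have hsp0 : s ^ (p - 1) ≠ 0 := by simp [ENNReal.rpow_eq_zero_iff_of_pos hp1, hs0]
  have hspt : s ^ (p - 1) ≠ ∞ := ENNReal.rpow_ne_top_of_nonneg hp1.le hst
  have hνp0 : ν C ^ p ≠ 0 := by simp [ENNReal.rpow_eq_zero_iff_of_pos (by linarith : 0 < p), hν0]
  have hνpt : ν C ^ p ≠ ∞ := ENNReal.rpow_ne_top_of_nonneg (by linarith) hνt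
  have hνeq : ν C ^ p = ν C ^ (p - 1) * ν C := by
    nth_rw 3 [← ENNReal.rpow_one (ν C)]
    rw [← ENNReal.rpow_add _ _ hν0 hνt, sub_add_cancel]
  rw [← ENNReal.mul_le_mul_iff_left hνp0 hνpt]
  calc (F / ν C) ^ (p - 1) * ν C ^ p = F ^ (p - 1) * ν C := by
        rw [hνeq, ← mul_assoc, ← ENNReal.mul_rpow_of_nonneg _ _ hp1.le,
          ENNReal.div_mul_cancel hν0 hνt]
    _ = s ^ (p - 1) * ((F / s) ^ (p - 1) * ν C) := by
        rw [← mul_assoc, ← ENNReal.mul_rpow_of_nonneg _ _ hp1.le, mul_comm s,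
          ENNReal.div_mul_cancel hs0 hst]
    _ ≤ s ^ (p - 1) * (w * n x) := by gcongr
    _ = w * s ^ (p - 1) * n x := by ring
    _ ≤ K * ν C ^ p * n x := mul_le_mul_left (h i) _
    _ = K * n x * ν C ^ p := by ring

/-- **Muckenhoupt's theorem**: the maximal operator is bounded on `L_p(W)` for `W` in `A_p`. -/
theorem HasAp.lintegral_maximal_rpow_mul_le [Countable I] [SFinite ν] (𝓑 : DoublingBasis ν I D)
    (hp : 1 < p) (hW : IsPosWeight W) (hK : K ≠ ∞) (h : HasAp 𝓑.carrier ν p W K)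
    {f : X → ℝ≥0∞} (hf : Measurable f) :
    ∫⁻ x, maximal 𝓑.carrier ν f x ^ p * W x ∂ν ≤
      maximalConst p D K * ∫⁻ x, f x ^ p * W x ∂ν := by
  have hp0 : 0 < p := by linarith
  have hp1 : 0 < p - 1 := by linarith
  set q := p / (p - 1) with hq
  have hq1 : 1 < q := one_lt_conj hp
  have hq0 : 0 < q := by linarith
  set σ : X → ℝ≥0∞ := fun z => W z ^ (-1 / (p - 1)) with hσdef
  have hσ : IsPosWeight σ := hW.rpow _
  set m := maximal 𝓑.carrier (ν.withDensity σ) (fun z => f z / σ z) with hm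
  have hmm : Measurable m := measurable_maximal 𝓑.measurableSet _ _
  have hh : Measurable fun y => m y ^ (p - 1) / W y := (hmm.pow_const _).div hW.measurable
  set n := maximal 𝓑.carrier (ν.withDensity W) (fun y => m y ^ (p - 1) / W y) with hn
  have hnm : Measurable n := measurable_maximal 𝓑.measurableSet _ _
  have hKσ : K ^ (1 / (p - 1)) ≠ ∞ := ENNReal.rpow_ne_top_of_nonneg (by positivity) hK
  -- Each weighted maximal operator is bounded for its own doubling measure: first in L_q(W dν),
  -- then in L_p(σ dν). The exponents fit because (p-1)q = p, W^(1-q) = σ and σ^(1-p) = W.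
  calc ∫⁻ x, maximal 𝓑.carrier ν f x ^ p * W x ∂ν
      ≤ ∫⁻ x, K ^ q * (W x * n x ^ q) ∂ν := by
        refine lintegral_mono fun x => ?_
        have := ENNReal.rpow_le_rpow (maximal_rpow_le 𝓑 hp hW hK h hf x) hq0.le
        rw [← ENNReal.rpow_mul, ENNReal.mul_rpow_of_nonneg _ _ hq0.le,
          show (p - 1) * q = p by rw [hq]; field_simp] at this
        calc _ ≤ _ := mul_le_mul_left this (W x)
          _ = _ := by rw [mul_assoc, mul_comm (W x)]
    _ = K ^ q * ∫⁻ x, W x * n x ^ q ∂ν :=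
        lintegral_const_mul _ (hW.measurable.mul (hnm.pow_const _))
    _ ≤ K ^ q * (K * D ^ p * ENNReal.ofReal (2 ^ q * q / (q - 1)) *
          ∫⁻ x, W x * (m x ^ (p - 1) / W x) ^ q ∂ν) := by
        gcongr
        exact h.lintegral_maximal_withDensity_le 𝓑 hp hW hK hh hq1
    _ = K ^ q * (K * D ^ p * ENNReal.ofReal (2 ^ q * q / (q - 1)) *
          ∫⁻ x, σ x * m x ^ p ∂ν) := by
        congr 2
        refine lintegral_congr fun x => ?_
        rw [ENNReal.div_rpow_of_nonneg _ _ hq0.le, ← ENNReal.rpow_mul,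
          show (p - 1) * q = p by rw [hq]; field_simp, ENNReal.div_eq_inv_mul, ← mul_assoc,
          ← ENNReal.rpow_neg]
        congr 1
        nth_rw 1 [← ENNReal.rpow_one (W x)]
        rw [← ENNReal.rpow_add _ _ (hW.ne_zero x) (hW.ne_top x)]
        simp only [hσdef]
        congr 1
        rw [hq]
        field_simp
        ring
    _ ≤ K ^ q * (K * D ^ p * ENNReal.ofReal (2 ^ q * q / (q - 1)) *
          (K ^ (1 / (p - 1)) * D ^ q * ENNReal.ofReal (2 ^ p * p / (p - 1)) *
            ∫⁻ x, σ x * (f x / σ x) ^ p ∂ν)) := by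
        gcongr
        exact (h.dual hp).lintegral_maximal_withDensity_le 𝓑 hq1 hσ hKσ (hf.div hσ.measurable) hp
    _ = K ^ q * (K * D ^ p * ENNReal.ofReal (2 ^ q * q / (q - 1)) *
          (K ^ (1 / (p - 1)) * D ^ q * ENNReal.ofReal (2 ^ p * p / (p - 1)) *
            ∫⁻ x, f x ^ p * W x ∂ν)) := by
        congr 3
        refine lintegral_congr fun x => ?_
        rw [ENNReal.div_rpow_of_nonneg _ _ hp0.le, ENNReal.div_eq_inv_mul, ← mul_assoc,
          mul_comm (f x ^ p), ← ENNReal.rpow_neg]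
        congr 1
        nth_rw 1 [← ENNReal.rpow_one (σ x)]
        rw [← ENNReal.rpow_add _ _ (hσ.ne_zero x) (hσ.ne_top x)]
        simp only [hσdef]
        rw [← ENNReal.rpow_mul, show -1 / (p - 1) * (1 + -p) = 1 by field_simp; ring,
          ENNReal.rpow_one]
    _ = _ := by
        unfold maximalConst
        simp only [mul_assoc]
        rfl

end Muckenhoupt

/-! ### Weighted Lebesgue norms -/

/-- The norm of `f` in `L_p(W dν)`. -/
noncomputable def lpNormW {X : Type*} [MeasurableSpace X] (ν : Measure X) (p : ℝ)
    (W f : X → ℝ≥0∞) : ℝ≥0∞ :=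
  (∫⁻ x, f x ^ p * W x ∂ν) ^ (1 / p)

section LpNormW

variable {X : Type*} [MeasurableSpace X] {ν : Measure X} {p : ℝ} {W : X → ℝ≥0∞}

theorem lpNormW_rpow (hp : 0 < p) (f : X → ℝ≥0∞) :
    lpNormW ν p W f ^ p = ∫⁻ x, f x ^ p * W x ∂ν := by
  rw [lpNormW, ← ENNReal.rpow_mul, one_div_mul_cancel hp.ne', ENNReal.rpow_one]

theorem lpNormW_eq (hp : 0 < p) (f : X → ℝ≥0∞) :
    lpNormW ν p W f = (∫⁻ x, (f x * W x ^ (1 / p)) ^ p ∂ν) ^ (1 / p) := by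
  rw [lpNormW]
  congr 1
  refine lintegral_congr fun x => ?_
  rw [ENNReal.mul_rpow_of_nonneg _ _ hp.le, ← ENNReal.rpow_mul, one_div_mul_cancel hp.ne',
    ENNReal.rpow_one]

theorem lpNormW_const_mul (hp : 0 < p) (hW : Measurable W) {f : X → ℝ≥0∞} (hf : Measurable f)
    (c : ℝ≥0∞) : lpNormW ν p W (fun x => c * f x) = c * lpNormW ν p W f := by
  unfold lpNormW
  simp_rw [ENNReal.mul_rpow_of_nonneg _ _ hp.le, mul_assoc]
  rw [lintegral_const_mul _ (by fun_prop), ENNReal.mul_rpow_of_nonneg _ _ (by positivity),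
    ← ENNReal.rpow_mul, mul_one_div_cancel hp.ne', ENNReal.rpow_one]

theorem lpNormW_add_le (hp : 1 ≤ p) (hW : Measurable W) {f g : X → ℝ≥0∞} (hf : Measurable f)
    (hg : Measurable g) :
    lpNormW ν p W (fun x => f x + g x) ≤ lpNormW ν p W f + lpNormW ν p W g := by
  have hp0 : 0 < p := by linarith
  rw [lpNormW_eq hp0, lpNormW_eq hp0, lpNormW_eq hp0]
  simp_rw [add_mul]
  exact ENNReal.lintegral_Lp_add_le (hf.mul (hW.pow_const _)).aemeasurable
    (hg.mul (hW.pow_const _)).aemeasurable hp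

/-- Minkowski's inequality for partial sums, followed by monotone convergence. -/
theorem lpNormW_tsum_le (hp : 1 ≤ p) (hW : Measurable W) {f : ℕ → X → ℝ≥0∞}
    (hf : ∀ n, Measurable (f n)) :
    lpNormW ν p W (fun x => ∑' n, f n x) ≤ ∑' n, lpNormW ν p W (f n) := by
  have hp0 : 0 < p := by linarith
  have hfin : ∀ n : ℕ, lpNormW ν p W (fun x => ∑ k ∈ Finset.range n, f k x) ≤
      ∑ k ∈ Finset.range n, lpNormW ν p W (f k) := by
    intro n
    induction n with
    | zero => simp [lpNormW, hp0]
    | succ n ih =>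
      simp_rw [Finset.sum_range_succ]
      exact (lpNormW_add_le hp hW (Finset.measurable_sum _ fun k _ => hf k) (hf n)).trans
        (by gcongr)
  have hle : ∀ n : ℕ, ∫⁻ x, (∑ k ∈ Finset.range n, f k x) ^ p * W x ∂ν ≤
      (∑' n, lpNormW ν p W (f n)) ^ p := by
    intro n
    rw [← lpNormW_rpow hp0]
    gcongr
    exact (hfin n).trans (ENNReal.sum_le_tsum _)
  have hiSup : ∫⁻ x, (∑' n, f n x) ^ p * W x ∂ν ≤ (∑' n, lpNormW ν p W (f n)) ^ p := by
    have : ∀ x, (∑' n, f n x) ^ p * W x = ⨆ n : ℕ, (∑ k ∈ Finset.range n, f k x) ^ p * W x := by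
      intro x
      rw [ENNReal.tsum_eq_iSup_nat, ← ENNReal.iSup_mul]
      congr 1
      exact (ENNReal.orderIsoRpow p hp0).map_iSup _
    simp_rw [this]
    rw [lintegral_iSup]
    · exact iSup_le hle
    · exact fun n => ((Finset.measurable_sum _ fun k _ => hf k).pow_const p).mul hW
    · intro n m hnm x
      dsimp only
      gcongr
  have := ENNReal.rpow_le_rpow hiSup (z := 1 / p) (by positivity)
  rwa [← ENNReal.rpow_mul, mul_one_div_cancel hp0.ne', ENNReal.rpow_one] at this

/-- With the dual weight in the second norm, the two weight factors are W^(1/p) and W^(-1/p) and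
cancel, so the pairing is with respect to ν alone. -/
theorem lintegral_mul_le_lpNormW_mul (hp : 1 < p) (hW : IsPosWeight W) {f g : X → ℝ≥0∞}
    (hf : Measurable f) (hg : Measurable g) :
    ∫⁻ x, f x * g x ∂ν ≤ lpNormW ν p W f *
      lpNormW ν (p / (p - 1)) (fun x => W x ^ (-1 / (p - 1))) g := by
  have hp0 : 0 < p := by linarith
  have hp1 : 0 < p - 1 := by linarith
  rw [lpNormW_eq hp0, lpNormW_eq (by positivity)]
  refine le_trans (le_of_eq ?_) (ENNReal.lintegral_mul_le_Lp_mul_Lq ν (holderConjugate_conj hp)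
    (hf.mul (hW.measurable.pow_const _)).aemeasurable
    (hg.mul ((hW.rpow _).measurable.pow_const _)).aemeasurable)
  refine lintegral_congr fun x => ?_
  simp only [Pi.mul_apply]
  rw [← ENNReal.rpow_mul, mul_mul_mul_comm, ← ENNReal.rpow_add _ _ (hW.ne_zero x) (hW.ne_top x)]
  rw [show 1 / p + -1 / (p - 1) * (1 / (p / (p - 1))) = 0 by field_simp; ring]
  simp

theorem ae_ne_top_of_lpNormW_ne_top (hp : 0 < p) (hW : IsPosWeight W) {f : X → ℝ≥0∞}
    (hf : Measurable f) (h : lpNormW ν p W f ≠ ∞) : ∀ᵐ x ∂ν, f x ≠ ∞ := by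
  have h1 : ∫⁻ x, f x ^ p * W x ∂ν ≠ ∞ := by
    rw [← lpNormW_rpow hp]
    exact ENNReal.rpow_ne_top_of_nonneg hp.le h
  filter_upwards [ae_lt_top ((hf.pow_const p).mul hW.measurable) h1] with x hx hfx
  rw [Pi.mul_apply, hfx, ENNReal.top_rpow_of_pos hp, ENNReal.top_mul (hW.ne_zero x)] at hx
  exact lt_irrefl _ hx

/-- The 1/p-th power of a positive function with small integral for the σ-finite measure W dν. It
serves to make functions strictly positive at small cost. -/
theorem exists_pos_lpNormW_le [SigmaFinite ν] (hp : 0 < p) (hW : IsPosWeight W) {ε : ℝ≥0∞}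
    (hε : ε ≠ 0) : ∃ φ : X → ℝ≥0∞, Measurable φ ∧ (∀ x, φ x ≠ 0) ∧ lpNormW ν p W φ ≤ ε := by
  have : SigmaFinite (ν.withDensity W) :=
    SigmaFinite.withDensity_of_ne_top (Filter.Eventually.of_forall hW.ne_top)
  have hε' : ε ^ p ≠ 0 := by simp [ENNReal.rpow_eq_zero_iff_of_pos hp, hε]
  obtain ⟨g, hg0, hgm, hg⟩ := exists_pos_lintegral_lt_of_sigmaFinite (ν.withDensity W) hε'
  refine ⟨fun x => (g x : ℝ≥0∞) ^ (1 / p), hgm.coe_nnreal_ennreal.pow_const _, fun x => ?_, ?_⟩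
  · rw [Ne, ENNReal.rpow_eq_zero_iff_of_pos (by positivity)]
    exact_mod_cast (hg0 x).ne'
  · rw [lintegral_withDensity_eq_lintegral_mul _ hW.measurable hgm.coe_nnreal_ennreal] at hg
    rw [lpNormW]
    refine (ENNReal.rpow_le_rpow (le_trans (le_of_eq ?_) hg.le) (by positivity)).trans
      (le_of_eq ?_)
    · refine lintegral_congr fun x => ?_
      rw [← ENNReal.rpow_mul, one_div_mul_cancel hp.ne', ENNReal.rpow_one, mul_comm]
      rfl
    · rw [← ENNReal.rpow_mul, mul_one_div_cancel hp.ne', ENNReal.rpow_one]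

end LpNormW

/-! ### The Rubio de Francia iteration -/

section RubioDeFrancia

variable {X I : Type*} [MeasurableSpace X] {ν : Measure X} {D K : ℝ≥0∞} {p : ℝ}
  {W : X → ℝ≥0∞}

/-- The Rubio de Francia iteration `∑ n, b⁻ⁿ Mⁿ h`. -/
noncomputable def iteration (C : I → Set X) (ν : Measure X) (b : ℝ≥0∞) (h : X → ℝ≥0∞)
    (x : X) : ℝ≥0∞ :=
  ∑' n : ℕ, b⁻¹ ^ n * (maximal C ν)^[n] h x

theorem measurable_iterate_maximal [Countable I] {C : I → Set X} (hC : ∀ i, MeasurableSet (C i))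
    {h : X → ℝ≥0∞} (hh : Measurable h) (n : ℕ) : Measurable ((maximal C ν)^[n] h) := by
  cases n with
  | zero => exact hh
  | succ n =>
    rw [Function.iterate_succ_apply']
    exact measurable_maximal hC _ _

theorem measurable_iteration [Countable I] {C : I → Set X} (hC : ∀ i, MeasurableSet (C i))
    (b : ℝ≥0∞) {h : X → ℝ≥0∞} (hh : Measurable h) : Measurable (iteration C ν b h) :=
  Measurable.tsum fun n => (measurable_iterate_maximal hC hh n).const_mul _

theorem le_iteration (C : I → Set X) (b : ℝ≥0∞) (h : X → ℝ≥0∞) (x : X) :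
    h x ≤ iteration C ν b h x := by
  refine le_trans ?_ (ENNReal.le_tsum 0)
  simp

/-- The iteration is an A_1 function: the maximal operator is countably subadditive, and applying it
term by term shifts the series by one index at the cost of a factor `b`. -/
theorem maximal_iteration_le [Countable I] {C : I → Set X} (hC : ∀ i, MeasurableSet (C i))
    {b : ℝ≥0∞} (hb0 : b ≠ 0) (hbt : b ≠ ∞) {h : X → ℝ≥0∞} (hh : Measurable h) (x : X) :
    maximal C ν (iteration C ν b h) x ≤ b * iteration C ν b h x := by
  refine iSup_le fun i => ?_
  by_cases hx : x ∈ C i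
  swap
  · simp [hx]
  rw [Set.indicator_of_mem hx]
  simp only [iteration]
  rw [lintegral_tsum fun n => ((measurable_iterate_maximal hC hh n).const_mul _).aemeasurable,
    ENNReal.div_eq_inv_mul, ← ENNReal.tsum_mul_left]
  calc ∑' n : ℕ, (ν (C i))⁻¹ * ∫⁻ y in C i, b⁻¹ ^ n * (maximal C ν)^[n] h y ∂ν
      ≤ ∑' n : ℕ, b * (b⁻¹ ^ (n + 1) * (maximal C ν)^[n + 1] h x) := by
        refine ENNReal.tsum_le_tsum fun n => ?_
        rw [lintegral_const_mul _ (measurable_iterate_maximal hC hh n), pow_succ, ← mul_assoc b,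
          mul_comm _ b⁻¹, ← mul_assoc b, ENNReal.mul_inv_cancel hb0 hbt, one_mul, mul_left_comm,
          ← ENNReal.div_eq_inv_mul, Function.iterate_succ_apply']
        gcongr
        exact average_le_maximal ν _ hx
    _ = b * ∑' n : ℕ, b⁻¹ ^ (n + 1) * (maximal C ν)^[n + 1] h x := ENNReal.tsum_mul_left
    _ ≤ b * ∑' n : ℕ, b⁻¹ ^ n * (maximal C ν)^[n] h x := by
        refine mul_le_mul_right ?_ b
        exact ENNReal.tsum_comp_le_tsum_of_injective (add_left_injective 1)
          (fun n => b⁻¹ ^ n * (maximal C ν)^[n] h x)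

/-- Twice a bound for the norm of the maximal operator on `L_p(W)`. -/
noncomputable def iterationConst (p : ℝ) (D K : ℝ≥0∞) : ℝ≥0∞ :=
  2 * (maximalConst p D K + 1) ^ (1 / p)

/-- The summand 1 in the definition is there for this: `maximalConst` vanishes for `K = 0`, while
the iteration divides by the constant. -/
theorem iterationConst_ne_zero (hp : 1 < p) : iterationConst p D K ≠ 0 := by
  unfold iterationConst
  rw [mul_ne_zero_iff]
  refine ⟨by simp, ?_⟩
  rw [Ne, ENNReal.rpow_eq_zero_iff_of_pos (by positivity)]
  simp

theorem iterationConst_ne_top (hp : 1 < p) (hD : D ≠ ∞) (hK : K ≠ ∞) :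
    iterationConst p D K ≠ ∞ := by
  unfold iterationConst
  refine ENNReal.mul_ne_top (by simp) (ENNReal.rpow_ne_top_of_nonneg (by positivity) ?_)
  exact ENNReal.add_ne_top.2 ⟨maximalConst_ne_top hp hD hK, by simp⟩

theorem HasAp.lpNormW_maximal_le [Countable I] [SFinite ν] (𝓑 : DoublingBasis ν I D)
    (hp : 1 < p) (hW : IsPosWeight W) (hK : K ≠ ∞) (h : HasAp 𝓑.carrier ν p W K)
    {f : X → ℝ≥0∞} (hf : Measurable f) :
    lpNormW ν p W (maximal 𝓑.carrier ν f) ≤ iterationConst p D K / 2 * lpNormW ν p W f := by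
  have hp0 : 0 < p := by linarith
  rw [iterationConst, ENNReal.div_eq_inv_mul, ← mul_assoc,
    ENNReal.inv_mul_cancel (by simp) (by simp), one_mul, lpNormW, lpNormW,
    ← ENNReal.mul_rpow_of_nonneg _ _ (by positivity)]
  gcongr
  refine (h.lintegral_maximal_rpow_mul_le 𝓑 hp hW hK hf).trans ?_
  gcongr
  exact le_self_add

/-- Half the constant already bounds the maximal operator, so the n-th term has norm at most 2⁻ⁿ
times that of `f`, and the geometric series sums to 2. -/
theorem HasAp.lpNormW_iteration_le [Countable I] [SFinite ν] (𝓑 : DoublingBasis ν I D)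
    (hp : 1 < p) (hW : IsPosWeight W) (hD : D ≠ ∞) (hK : K ≠ ∞) (h : HasAp 𝓑.carrier ν p W K)
    {f : X → ℝ≥0∞} (hf : Measurable f) :
    lpNormW ν p W (iteration 𝓑.carrier ν (iterationConst p D K) f) ≤ 2 * lpNormW ν p W f := by
  have hp0 : 0 < p := by linarith
  set b := iterationConst p D K
  have hb0 : b ≠ 0 := iterationConst_ne_zero hp
  have hbt : b ≠ ∞ := iterationConst_ne_top hp hD hK
  have hM := fun n => measurable_iterate_maximal (ν := ν) 𝓑.measurableSet hf n
  have hn : ∀ n : ℕ, lpNormW ν p W ((maximal 𝓑.carrier ν)^[n] f) ≤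
      (b / 2) ^ n * lpNormW ν p W f := by
    intro n
    induction n with
    | zero => simp
    | succ n ih =>
      rw [Function.iterate_succ_apply', pow_succ', mul_assoc]
      exact (h.lpNormW_maximal_le 𝓑 hp hW hK (hM n)).trans (by gcongr)
  calc lpNormW ν p W (iteration 𝓑.carrier ν b f)
      ≤ ∑' n : ℕ, lpNormW ν p W (fun x => b⁻¹ ^ n * (maximal 𝓑.carrier ν)^[n] f x) :=
        lpNormW_tsum_le hp.le hW.measurable fun n => (hM n).const_mul _
    _ ≤ ∑' n : ℕ, (2⁻¹ : ℝ≥0∞) ^ n * lpNormW ν p W f := by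
        refine ENNReal.tsum_le_tsum fun n => ?_
        rw [lpNormW_const_mul hp0 hW.measurable (hM n)]
        calc b⁻¹ ^ n * lpNormW ν p W ((maximal 𝓑.carrier ν)^[n] f)
            ≤ b⁻¹ ^ n * ((b / 2) ^ n * lpNormW ν p W f) := by gcongr; exact hn n
          _ = _ := by
            rw [← mul_assoc, ← mul_pow, div_eq_mul_inv, ← mul_assoc,
              ENNReal.inv_mul_cancel hb0 hbt, one_mul]
    _ = 2 * lpNormW ν p W f := by
        rw [ENNReal.tsum_mul_right, ENNReal.tsum_geometric, ENNReal.one_sub_inv_two, inv_inv]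

end RubioDeFrancia

/-! ### Extrapolation from one exponent to another -/

section Extrapolation

variable {X I : Type*} [MeasurableSpace X] {ν : Measure X} {D K : ℝ≥0∞} {p q : ℝ}
  {W : X → ℝ≥0∞}

theorem rpow_le_rpow_of_nonpos {x y : ℝ≥0∞} {z : ℝ} (hz : z ≤ 0) (h : x ≤ y) :
    y ^ z ≤ x ^ z := by
  rw [← neg_neg z, ENNReal.rpow_neg y (-z), ENNReal.rpow_neg x (-z), ENNReal.inv_le_inv]
  exact ENNReal.rpow_le_rpow h (by linarith)

open Classical in
/-- The weight `H ^ (1 - p) * S`, redefined as `1` where it could fail to lie in `(0, ∞)`. -/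
noncomputable def factorWeight (p : ℝ) (H S : X → ℝ≥0∞) (x : X) : ℝ≥0∞ :=
  if H x ≠ ∞ ∧ S x ≠ ∞ then H x ^ (1 - p) * S x else 1

theorem isPosWeight_factorWeight {H S : X → ℝ≥0∞} (hH : Measurable H) (hS : Measurable S)
    (hH0 : ∀ x, H x ≠ 0) (hS0 : ∀ x, S x ≠ 0) : IsPosWeight (factorWeight p H S) := by
  classical
  refine ⟨?_, fun x => ?_, fun x => ?_⟩
  · refine Measurable.ite ?_ ((hH.pow_const _).mul hS) measurable_const
    exact ((measurableSet_singleton _).preimage hH).compl.inter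
      ((measurableSet_singleton _).preimage hS).compl
  · unfold factorWeight
    split_ifs with h
    · exact mul_ne_zero (ENNReal.rpow_pos (hH0 x).bot_lt h.1).ne' (hS0 x)
    · exact one_ne_zero
  · unfold factorWeight
    split_ifs with h
    · exact ENNReal.mul_ne_top (ENNReal.rpow_ne_top_of_ne_zero (hH0 x) h.1) h.2
    · exact ENNReal.one_ne_top

/-- If `H` and `S` are `A_1` weights, then `H ^ (1 - p) * S` is an `A_p` weight. -/
theorem hasAp_factorWeight (𝓑 : DoublingBasis ν I D) (hp : 1 < p) {H S : X → ℝ≥0∞}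
    (hH : Measurable H) (hS : Measurable S) (hH0 : ∀ x, H x ≠ 0) (hS0 : ∀ x, S x ≠ 0)
    (hHt : ∀ᵐ x ∂ν, H x ≠ ∞) (hSt : ∀ᵐ x ∂ν, S x ≠ ∞) {b c : ℝ≥0∞} (hb0 : b ≠ 0) (hbt : b ≠ ∞)
    (hc0 : c ≠ 0) (hct : c ≠ ∞) (hMH : ∀ x, maximal 𝓑.carrier ν H x ≤ b * H x)
    (hMS : ∀ x, maximal 𝓑.carrier ν S x ≤ c * S x) :
    HasAp 𝓑.carrier ν p (factorWeight p H S) (b ^ (p - 1) * c) := by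
  intro i
  have hp1 : 0 < p - 1 := by linarith
  set C := 𝓑.carrier i
  have hCm : MeasurableSet C := 𝓑.measurableSet i
  have hν0 : ν C ≠ 0 := 𝓑.measure_ne_zero i
  have hνt : ν C ≠ ∞ := 𝓑.measure_ne_top i
  -- An A_1 function is bounded below on `C` by its average divided by its A_1 constant. Negative
  -- powers of it are therefore bounded by a constant on `C`, and only the other factor has to be
  -- integrated.
  have key : ∀ {F : X → ℝ≥0∞} {a : ℝ≥0∞}, Measurable F → (∀ x, F x ≠ 0) → (∀ᵐ x ∂ν, F x ≠ ∞) →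
      a ≠ 0 → a ≠ ∞ → (∀ x, maximal 𝓑.carrier ν F x ≤ a * F x) →
      ∃ α : ℝ≥0∞, α ≠ 0 ∧ α ≠ ∞ ∧ (∀ x ∈ C, α ≤ F x) ∧ ∫⁻ x in C, F x ∂ν = a * α * ν C := by
    intro F a hF hF0 hFt ha0 hat hM
    have hle : ∀ x ∈ C, (∫⁻ y in C, F y ∂ν) / ν C / a ≤ F x := by
      intro x hx
      rw [ENNReal.div_le_iff ha0 hat, mul_comm]
      exact (average_le_maximal (C := 𝓑.carrier) ν F hx).trans (hM x)
    refine ⟨(∫⁻ x in C, F x ∂ν) / ν C / a, ?_, ?_, hle, ?_⟩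
    · have h0 : ∫⁻ x in C, F x ∂ν ≠ 0 := by
        intro h
        rw [lintegral_eq_zero_iff hF] at h
        have h2 : ∀ᵐ x ∂ν.restrict C, False := h.mono fun x hx => hF0 x hx
        rw [ae_iff] at h2
        simp [hν0] at h2
      exact ENNReal.div_ne_zero.2 ⟨ENNReal.div_ne_zero.2 ⟨h0, hνt⟩, hat⟩
    · have : ∃ x ∈ C, F x ≠ ∞ := by
        by_contra! hcon
        apply hν0
        exact measure_mono_null (fun x hx => by simpa using hcon x hx) hFt
      obtain ⟨x, hx, hFx⟩ := this
      exact ne_top_of_le_ne_top hFx (hle x hx)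
    · rw [ENNReal.mul_div_cancel ha0 hat, ENNReal.div_mul_cancel hν0 hνt]
  obtain ⟨α, hα0, hαt, hαle, hαint⟩ := key hH hH0 hHt hb0 hbt hMH
  obtain ⟨β, hβ0, hβt, hβle, hβint⟩ := key hS hS0 hSt hc0 hct hMS
  have h1 : ∫⁻ x in C, factorWeight p H S x ∂ν ≤ α ^ (1 - p) * (c * β * ν C) := by
    rw [← hβint, ← lintegral_const_mul _ hS]
    refine lintegral_mono_ae ?_
    filter_upwards [ae_restrict_mem hCm, ae_restrict_of_ae hHt, ae_restrict_of_ae hSt]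
      with x hx hx1 hx2
    rw [factorWeight, if_pos ⟨hx1, hx2⟩]
    exact mul_le_mul_left (rpow_le_rpow_of_nonpos (by linarith) (hαle x hx)) _
  have h2 : ∫⁻ x in C, factorWeight p H S x ^ (-1 / (p - 1)) ∂ν ≤
      β ^ (-1 / (p - 1)) * (b * α * ν C) := by
    rw [← hαint, ← lintegral_const_mul _ hH]
    refine lintegral_mono_ae ?_
    filter_upwards [ae_restrict_mem hCm, ae_restrict_of_ae hHt, ae_restrict_of_ae hSt]
      with x hx hx1 hx2
    rw [factorWeight, if_pos ⟨hx1, hx2⟩, ENNReal.mul_rpow_of_ne_top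
      (ENNReal.rpow_ne_top_of_ne_zero (hH0 x) hx1) hx2, ← ENNReal.rpow_mul,
      show (1 - p) * (-1 / (p - 1)) = 1 by field_simp; ring, ENNReal.rpow_one, mul_comm]
    refine mul_le_mul_left (rpow_le_rpow_of_nonpos ?_ (hβle x hx)) _
    exact div_nonpos_of_nonpos_of_nonneg (by norm_num) hp1.le
  have hαα : α ^ (1 - p) * α ^ (p - 1) = 1 := by
    rw [← ENNReal.rpow_add _ _ hα0 hαt]
    simp
  have hνν : ν C * ν C ^ (p - 1) = ν C ^ p := by
    nth_rw 1 [← ENNReal.rpow_one (ν C)]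
    rw [← ENNReal.rpow_add _ _ hν0 hνt]
    congr 1
    ring
  calc _ ≤ α ^ (1 - p) * (c * β * ν C) * (β ^ (-1 / (p - 1)) * (b * α * ν C)) ^ (p - 1) := by
        gcongr
    _ = α ^ (1 - p) * (c * β * ν C) * (β⁻¹ * (b ^ (p - 1) * α ^ (p - 1) * ν C ^ (p - 1))) := by
        rw [ENNReal.mul_rpow_of_nonneg _ _ hp1.le, ENNReal.mul_rpow_of_nonneg _ _ hp1.le,
          ENNReal.mul_rpow_of_nonneg _ _ hp1.le, ← ENNReal.rpow_mul,
          show -1 / (p - 1) * (p - 1) = -1 by field_simp, ENNReal.rpow_neg_one]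
    _ = (α ^ (1 - p) * α ^ (p - 1)) * (β * β⁻¹) * (b ^ (p - 1) * c) *
          (ν C * ν C ^ (p - 1)) := by ring
    _ = _ := by rw [hαα, ENNReal.mul_inv_cancel hβ0 hβt, hνν, one_mul, one_mul]

/-- The weighted estimate with the weight `H ^ (1 - p) * S` yields an estimate in `L_1(S)`. -/
theorem lintegral_mul_le_of_factorWeight (hp : 1 < p) {H S U G : X → ℝ≥0∞}
    (hH : Measurable H) (hS : Measurable S) (hU : Measurable U) (hH0 : ∀ x, H x ≠ 0)
    (hHt : ∀ᵐ x ∂ν, H x ≠ ∞) (hSt : ∀ᵐ x ∂ν, S x ≠ ∞) (hGH : ∀ x, G x ≤ H x) {N : ℝ≥0∞}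
    (hV : Measurable (factorWeight p H S))
    (h : lpNormW ν p (factorWeight p H S) U ≤ N * lpNormW ν p (factorWeight p H S) G) :
    ∫⁻ x, U x * S x ∂ν ≤ N * ∫⁻ x, H x * S x ∂ν := by
  have hp0 : 0 < p := by linarith
  have hp1 : 0 < p - 1 := by linarith
  set V := factorWeight p H S with hVdef
  have hpc : 0 < p / (p - 1) := by positivity
  have hVe : ∀ᵐ x ∂ν, V x = H x ^ (1 - p) * S x := by
    filter_upwards [hHt, hSt] with x h1 h2
    rw [hVdef, factorWeight, if_pos ⟨h1, h2⟩]
  have hG : lpNormW ν p V G ≤ (∫⁻ x, H x * S x ∂ν) ^ (1 / p) := by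
    unfold lpNormW
    gcongr ?_ ^ (1 / p)
    refine lintegral_mono_ae ?_
    filter_upwards [hHt, hVe] with x h1 h2
    rw [h2, ← mul_assoc]
    gcongr
    calc G x ^ p * H x ^ (1 - p) ≤ H x ^ p * H x ^ (1 - p) := by gcongr; exact hGH x
      _ = H x := by
        rw [← ENNReal.rpow_add _ _ (hH0 x) h1]
        simp
  -- Since V^(1/p) = H^(-1/p') S^(1/p), Hölder's inequality applies to `U * S` written as the
  -- product of U V^(1/p), controlled by the hypothesis, and (H S)^(1/p').
  calc ∫⁻ x, U x * S x ∂ν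
      = ∫⁻ x, (U x * V x ^ (1 / p)) * (H x * S x) ^ (1 / (p / (p - 1))) ∂ν := by
        refine lintegral_congr_ae ?_
        filter_upwards [hHt, hSt, hVe] with x h1 h2 h3
        rw [h3, ENNReal.mul_rpow_of_nonneg _ _ (by positivity),
          ENNReal.mul_rpow_of_nonneg _ _ (by positivity), ← ENNReal.rpow_mul]
        have e1 : H x ^ ((1 - p) * (1 / p)) * H x ^ (1 / (p / (p - 1))) = 1 := by
          rw [← ENNReal.rpow_add _ _ (hH0 x) h1,
            show (1 - p) * (1 / p) + 1 / (p / (p - 1)) = 0 by field_simp; ring, ENNReal.rpow_zero]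
        have e2 : S x ^ (1 / p) * S x ^ (1 / (p / (p - 1))) = S x := by
          rw [← ENNReal.rpow_add_of_nonneg _ _ (by positivity) (by positivity),
            show 1 / p + 1 / (p / (p - 1)) = 1 by field_simp; ring, ENNReal.rpow_one]
        calc U x * S x = U x * ((H x ^ ((1 - p) * (1 / p)) * H x ^ (1 / (p / (p - 1)))) *
              (S x ^ (1 / p) * S x ^ (1 / (p / (p - 1))))) := by rw [e1, e2, one_mul]
          _ = _ := by ring
    _ ≤ (∫⁻ x, (U x * V x ^ (1 / p)) ^ p ∂ν) ^ (1 / p) *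
          (∫⁻ x, ((H x * S x) ^ (1 / (p / (p - 1)))) ^ (p / (p - 1)) ∂ν) ^ (1 / (p / (p - 1))) :=
        ENNReal.lintegral_mul_le_Lp_mul_Lq ν (holderConjugate_conj hp)
          (hU.mul (hV.pow_const _)).aemeasurable ((hH.mul hS).pow_const _).aemeasurable
    _ = lpNormW ν p V U * (∫⁻ x, H x * S x ∂ν) ^ (1 / (p / (p - 1))) := by
        rw [← lpNormW_eq hp0]
        simp_rw [← ENNReal.rpow_mul, one_div_mul_cancel hpc.ne', ENNReal.rpow_one]
    _ ≤ N * (∫⁻ x, H x * S x ∂ν) ^ (1 / p) * (∫⁻ x, H x * S x ∂ν) ^ (1 / (p / (p - 1))) := by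
        gcongr
        exact h.trans (by gcongr)
    _ = N * ∫⁻ x, H x * S x ∂ν := by
        rw [mul_assoc, ← ENNReal.rpow_add_of_nonneg _ _ (by positivity) (by positivity),
            show 1 / p + 1 / (p / (p - 1)) = 1 by field_simp; ring, ENNReal.rpow_one]

/-- The bound on the characteristic of the weights used to extrapolate from `p` to `q`. -/
noncomputable def extrapolationConst (p q : ℝ) (D K : ℝ≥0∞) : ℝ≥0∞ :=
  iterationConst q D K ^ (p - 1) * iterationConst (q / (q - 1)) D (K ^ (1 / (q - 1)))

theorem extrapolationConst_ne_top (hp : 1 < p) (hq : 1 < q) (hD : D ≠ ∞) (hK : K ≠ ∞) :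
    extrapolationConst p q D K ≠ ∞ := by
  have hq1 : 0 < q - 1 := by linarith
  refine ENNReal.mul_ne_top (ENNReal.rpow_ne_top_of_nonneg (by linarith)
    (iterationConst_ne_top hq hD hK)) (iterationConst_ne_top (one_lt_conj hq) hD ?_)
  exact ENNReal.rpow_ne_top_of_nonneg (by positivity) hK

/-- Duality form of the extrapolation estimate, with an additional error. -/
theorem lintegral_mul_le_of_forall_weight [Countable I] [SigmaFinite ν] (𝓑 : DoublingBasis ν I D)
    (hp : 1 < p) (hq : 1 < q) (hD : D ≠ ∞) (hK : K ≠ ∞) (hW : IsPosWeight W)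
    (hWA : HasAp 𝓑.carrier ν q W K) {U G h : X → ℝ≥0∞} (hU : Measurable U) (hG : Measurable G)
    (hh : Measurable h) (hGt : lpNormW ν q W G ≠ ∞)
    (hht : lpNormW ν (q / (q - 1)) (fun x => W x ^ (-1 / (q - 1))) h ≠ ∞) {N : ℝ≥0∞}
    (H : ∀ V : X → ℝ≥0∞, IsPosWeight V → HasAp 𝓑.carrier ν p V (extrapolationConst p q D K) →
      lpNormW ν p V U ≤ N * lpNormW ν p V G) {ε : ℝ≥0∞} (hε : ε ≠ 0) (hεt : ε ≠ ∞) :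
    ∫⁻ x, U x * h x ∂ν ≤ N * (4 * ((lpNormW ν q W G + ε) *
      (lpNormW ν (q / (q - 1)) (fun x => W x ^ (-1 / (q - 1))) h + ε))) := by
  have hq0 : 0 < q := by linarith
  have hq1 : 0 < q - 1 := by linarith
  have hc := one_lt_conj hq
  have hc0 : 0 < q / (q - 1) := by linarith
  have hKc : K ^ (1 / (q - 1)) ≠ ∞ := ENNReal.rpow_ne_top_of_nonneg (by positivity) hK
  set σ : X → ℝ≥0∞ := fun x => W x ^ (-1 / (q - 1))
  have hσ : IsPosWeight σ := hW.rpow _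
  -- Adding `φ` and `ψ` makes both iterations positive everywhere, as a weight with a negative power
  -- of `P` requires; they account for the error `ε`.
  obtain ⟨φ, hφ, hφ0, hφε⟩ := exists_pos_lpNormW_le (ν := ν) hq0 hW hε
  obtain ⟨ψ, hψ, hψ0, hψε⟩ := exists_pos_lpNormW_le (ν := ν) hc0 hσ hε
  set b := iterationConst q D K
  set c := iterationConst (q / (q - 1)) D (K ^ (1 / (q - 1)))
  have hb0 : b ≠ 0 := iterationConst_ne_zero hq
  have hbt : b ≠ ∞ := iterationConst_ne_top hq hD hK
  have hc0' : c ≠ 0 := iterationConst_ne_zero hc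
  have hct : c ≠ ∞ := iterationConst_ne_top hc hD hKc
  set P := iteration 𝓑.carrier ν b (fun x => G x + φ x)
  set S := iteration 𝓑.carrier ν c (fun x => h x + ψ x)
  have hPle : ∀ x, G x + φ x ≤ P x := le_iteration _ _ _
  have hSle : ∀ x, h x + ψ x ≤ S x := le_iteration _ _ _
  have hPm : Measurable P := measurable_iteration 𝓑.measurableSet _ (hG.add hφ)
  have hSm : Measurable S := measurable_iteration 𝓑.measurableSet _ (hh.add hψ)
  have hPn : lpNormW ν q W P ≤ 2 * (lpNormW ν q W G + ε) := by
    refine (hWA.lpNormW_iteration_le 𝓑 hq hW hD hK (hG.add hφ)).trans ?_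
    gcongr
    exact (lpNormW_add_le hq.le hW.measurable hG hφ).trans (by gcongr)
  have hSn : lpNormW ν (q / (q - 1)) σ S ≤ 2 * (lpNormW ν (q / (q - 1)) σ h + ε) := by
    refine ((hWA.dual hq).lpNormW_iteration_le 𝓑 hc hσ hD hKc (hh.add hψ)).trans ?_
    gcongr
    exact (lpNormW_add_le hc.le hσ.measurable hh hψ).trans (by gcongr)
  have hP0 : ∀ x, P x ≠ 0 := fun x hx => hφ0 x (by simpa [hx] using hPle x : G x = 0 ∧ φ x = 0).2
  have hS0 : ∀ x, S x ≠ 0 := fun x hx => hψ0 x (by simpa [hx] using hSle x : h x = 0 ∧ ψ x = 0).2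
  have hPt : ∀ᵐ x ∂ν, P x ≠ ∞ := ae_ne_top_of_lpNormW_ne_top hq0 hW hPm
    (ne_top_of_le_ne_top (by finiteness) hPn)
  have hSt : ∀ᵐ x ∂ν, S x ≠ ∞ := ae_ne_top_of_lpNormW_ne_top hc0 hσ hSm
    (ne_top_of_le_ne_top (by finiteness) hSn)
  have hV := isPosWeight_factorWeight (p := p) hPm hSm hP0 hS0
  have hest := H _ hV (hasAp_factorWeight 𝓑 hp hPm hSm hP0 hS0 hPt hSt hb0 hbt hc0' hct
    (maximal_iteration_le 𝓑.measurableSet hb0 hbt (hG.add hφ))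
    (maximal_iteration_le 𝓑.measurableSet hc0' hct (hh.add hψ)))
  calc ∫⁻ x, U x * h x ∂ν ≤ ∫⁻ x, U x * S x ∂ν := by
        gcongr with x
        exact le_self_add.trans (hSle x)
    _ ≤ N * ∫⁻ x, P x * S x ∂ν := lintegral_mul_le_of_factorWeight hp hPm hSm hU hP0 hPt hSt
        (fun x => le_self_add.trans (hPle x)) hV.measurable hest
    _ ≤ N * (lpNormW ν q W P * lpNormW ν (q / (q - 1)) σ S) := by
        gcongr
        exact lintegral_mul_le_lpNormW_mul hq hW hPm hSm
    _ ≤ N * ((2 * (lpNormW ν q W G + ε)) * (2 * (lpNormW ν (q / (q - 1)) σ h + ε))) := by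
        gcongr
    _ = _ := by ring

/-- **Rubio de Francia extrapolation** from `L_p` to `L_q` for a doubling basis. -/
theorem lpNormW_le_of_forall_weight [Countable I] [SigmaFinite ν] (𝓑 : DoublingBasis ν I D)
    (hp : 1 < p) (hq : 1 < q) (hD : D ≠ ∞) (hK : K ≠ ∞) (hW : IsPosWeight W)
    (hWA : HasAp 𝓑.carrier ν q W K) {U G : X → ℝ≥0∞} (hU : Measurable U) (hG : Measurable G)
    {N : ℝ≥0∞} (hN0 : N ≠ 0) (hN : N ≠ ∞)
    (H : ∀ V : X → ℝ≥0∞, IsPosWeight V → HasAp 𝓑.carrier ν p V (extrapolationConst p q D K) →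
      lpNormW ν p V U ≤ N * lpNormW ν p V G) :
    lpNormW ν q W U ≤ 4 * N * lpNormW ν q W G := by
  have hq0 : 0 < q := by linarith
  have hq1 : 0 < q - 1 := by linarith
  rcases eq_or_ne (lpNormW ν q W G) ∞ with hGt | hGt
  -- Here `N ≠ 0` excludes the product `0 * ∞ = 0`.
  · rw [hGt, ENNReal.mul_top (mul_ne_zero (by simp) hN0)]
    exact le_top
  -- The norm of `U` may be infinite and could then not be divided out, so minorants of finite norm
  -- are treated first.
  have key : ∀ f : X → ℝ≥0∞, Measurable f → (∀ x, f x ≤ U x) → lpNormW ν q W f ≠ ∞ →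
      lpNormW ν q W f ≤ 4 * N * lpNormW ν q W G := by
    intro f hf hfU hft
    rcases eq_or_ne (lpNormW ν q W f) 0 with hf0 | hf0
    · rw [hf0]
      exact zero_le
    set a := lpNormW ν q W f with ha
    set g := lpNormW ν q W G
    have hap0 : a ^ (q - 1) ≠ 0 := by simp [ENNReal.rpow_eq_zero_iff_of_pos hq1, hf0]
    have hapt : a ^ (q - 1) ≠ ∞ := ENNReal.rpow_ne_top_of_nonneg hq1.le hft
    -- This is the extremal function in duality: its pairing with `f` is `a ^ q` and its dual norm
    -- is `a ^ (q - 1)`.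
    have hh : Measurable fun x => f x ^ (q - 1) * W x := (hf.pow_const _).mul hW.measurable
    have hdual : lpNormW ν (q / (q - 1)) (fun x => W x ^ (-1 / (q - 1)))
        (fun x => f x ^ (q - 1) * W x) = a ^ (q - 1) := by
      have : ∀ x, (f x ^ (q - 1) * W x) ^ (q / (q - 1)) * W x ^ (-1 / (q - 1)) =
          f x ^ q * W x := by
        intro x
        rw [ENNReal.mul_rpow_of_nonneg _ _ (by positivity), ← ENNReal.rpow_mul, mul_assoc,
          ← ENNReal.rpow_add _ _ (hW.ne_zero x) (hW.ne_top x),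
          show (q - 1) * (q / (q - 1)) = q by field_simp,
          show q / (q - 1) + -1 / (q - 1) = 1 by field_simp; ring, ENNReal.rpow_one]
      rw [lpNormW]
      simp_rw [this]
      rw [← lpNormW_rpow hq0, ← ha, ← ENNReal.rpow_mul]
      congr 1
      field_simp
    have hle : ∀ ε : ℝ≥0∞, ε ≠ 0 → ε ≠ ∞ → a ^ q ≤ N * (4 * ((g + ε) * (a ^ (q - 1) + ε))) := by
      intro ε hε hεt
      have := lintegral_mul_le_of_forall_weight 𝓑 hp hq hD hK hW hWA hU hG hh hGt
        (by rwa [hdual]) H hε hεt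
      rw [hdual] at this
      refine le_trans ?_ this
      rw [ha, lpNormW_rpow hq0]
      refine lintegral_mono fun x => ?_
      rw [← mul_assoc]
      gcongr
      calc f x ^ q = f x ^ (1 : ℝ) * f x ^ (q - 1) := by
            rw [← ENNReal.rpow_add_of_nonneg _ _ zero_le_one hq1.le]
            congr 1
            ring
        _ ≤ _ := by
            rw [ENNReal.rpow_one]
            gcongr
            exact hfU x
    have hlim : a ^ q ≤ N * (4 * (g * a ^ (q - 1))) := by
      have ht : Filter.Tendsto (fun ε : ℝ≥0∞ => N * (4 * ((g + ε) * (a ^ (q - 1) + ε))))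
          (nhdsWithin 0 (Set.Ioi 0)) (nhds (N * (4 * ((g + 0) * (a ^ (q - 1) + 0))))) := by
        have hid : Filter.Tendsto (fun ε : ℝ≥0∞ => ε) (nhdsWithin 0 (Set.Ioi 0)) (nhds 0) :=
          nhdsWithin_le_nhds
        refine ENNReal.Tendsto.const_mul (ENNReal.Tendsto.const_mul (ENNReal.Tendsto.mul
          (tendsto_const_nhds.add hid) (.inr ?_) (tendsto_const_nhds.add hid) (.inr ?_))
          (.inr (by simp))) (.inr hN)
        · simpa using hapt
        · simpa using hGt
      rw [add_zero, add_zero] at ht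
      refine ge_of_tendsto ht ?_
      filter_upwards [self_mem_nhdsWithin, nhdsWithin_le_nhds (Iio_mem_nhds ENNReal.zero_lt_top)]
        with ε h1 h2
      exact hle ε (ne_of_gt h1) (ne_of_lt h2)
    rw [← ENNReal.mul_le_mul_iff_left hap0 hapt]
    calc a * a ^ (q - 1) = a ^ q := by
          nth_rw 1 [← ENNReal.rpow_one a]
          rw [← ENNReal.rpow_add_of_nonneg _ _ zero_le_one hq1.le]
          congr 1
          ring
      _ ≤ _ := hlim
      _ = _ := by ring
  have : SigmaFinite (ν.withDensity W) :=
    SigmaFinite.withDensity_of_ne_top (Filter.Eventually.of_forall hW.ne_top)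
  -- Truncating `U` in height and to sets of finite W dν-measure gives minorants of finite norm
  -- increasing to `U`.
  set E := spanningSets (ν.withDensity W) with hE
  have hEm := measurableSet_spanningSets (ν.withDensity W)
  set f : ℕ → X → ℝ≥0∞ := fun n => (E n).indicator fun x => min (U x) n
  have hfm : ∀ n, Measurable (f n) := fun n => (hU.min measurable_const).indicator (hEm n)
  have hfU : ∀ n x, f n x ≤ U x := fun n x => by
    refine Set.indicator_le (fun x _ => min_le_left _ _) x
  have hft : ∀ n, lpNormW ν q W (f n) ≠ ∞ := by
    intro n
    refine ENNReal.rpow_ne_top_of_nonneg (by positivity) ?_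
    refine ne_top_of_le_ne_top (b := (n : ℝ≥0∞) ^ q * ν.withDensity W (E n)) ?_ ?_
    · exact ENNReal.mul_ne_top (ENNReal.rpow_ne_top_of_nonneg hq0.le (by simp))
        (measure_spanningSets_lt_top _ n).ne
    · rw [withDensity_apply _ (hEm n), ← lintegral_const_mul _ hW.measurable,
        ← lintegral_indicator (hEm n)]
      refine lintegral_mono fun x => ?_
      by_cases hx : x ∈ E n
      · have hx' : x ∈ spanningSets (ν.withDensity W) n := hx
        simp only [f, Set.indicator_of_mem hx, Set.indicator_of_mem hx']
        gcongr
        exact min_le_right _ _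
      · simp [f, hx, hq0]
  have hmono : Monotone f := by
    intro n m hnm x
    by_cases hx : x ∈ E n
    · have hx' : x ∈ E m := monotone_spanningSets _ hnm hx
      simp only [f, Set.indicator_of_mem hx, Set.indicator_of_mem hx']
      gcongr
    · simp [f, hx]
  have hsup : ∀ x, U x = ⨆ n, f n x := by
    intro x
    refine le_antisymm ?_ (iSup_le fun n => hfU n x)
    refine le_of_forall_lt fun y hy => ?_
    obtain ⟨n, hn⟩ := ENNReal.exists_nat_gt (ne_top_of_lt hy)
    obtain ⟨k, hk⟩ : ∃ k, x ∈ E k := by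
      have : x ∈ ⋃ k, E k := by rw [hE, iUnion_spanningSets]; trivial
      simpa using this
    refine lt_of_lt_of_le ?_ (le_iSup _ (max n k))
    have hx : x ∈ E (max n k) := monotone_spanningSets _ (le_max_right _ _) hk
    simp only [f, Set.indicator_of_mem hx]
    refine lt_min hy (hn.trans_le ?_)
    exact_mod_cast le_max_left _ _
  have hint : ∫⁻ x, U x ^ q * W x ∂ν ≤ (4 * N * lpNormW ν q W G) ^ q := by
    have : ∀ x, U x ^ q * W x = ⨆ n : ℕ, f n x ^ q * W x := by
      intro x
      rw [hsup x, ← ENNReal.iSup_mul]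
      congr 1
      exact (ENNReal.orderIsoRpow q hq0).map_iSup _
    simp_rw [this]
    rw [lintegral_iSup (fun n => by have := hfm n; have := hW.measurable; fun_prop)]
    · refine iSup_le fun n => ?_
      rw [← lpNormW_rpow hq0]
      gcongr
      exact key _ (hfm n) (hfU n) (hft n)
    · intro n m hnm x
      dsimp only
      gcongr
      exact hmono hnm x
  rw [← lpNormW_rpow hq0] at hint
  exact (ENNReal.rpow_le_rpow_iff hq0).1 hint

end Extrapolation

/-! ### Anisotropic boxes as a doubling basis -/

section Boxes

variable {ι : Type*} {Ω : ι → Set ℝ} {k : ι → ℕ}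

theorem side_pos (n : ℤ) (c : ℕ) : (0 : ℝ) < 2 ^ (-(n * (c : ℤ))) := by positivity

theorem side_sub (n : ℤ) (r c : ℕ) :
    (2 : ℝ) ^ (-((n - r) * (c : ℤ))) = ((2 : ℝ) ^ r) ^ c * 2 ^ (-(n * (c : ℤ))) := by
  rw [← pow_mul, ← zpow_natCast, ← zpow_add₀ two_ne_zero]
  congr 1
  push_cast
  ring

theorem side_anti {n m : ℤ} (h : m ≤ n) (c : ℕ) :
    (2 : ℝ) ^ (-(n * (c : ℤ))) ≤ 2 ^ (-(m * (c : ℤ))) := by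
  refine zpow_le_zpow_right₀ one_le_two ?_
  have : m * (c : ℤ) ≤ n * c := mul_le_mul_of_nonneg_right h (by positivity)
  linarith

theorem mem_box_self (n : ℤ) (a : ι → ℝ) : a ∈ box k n a := by
  intro j _
  exact ⟨le_rfl, by linarith [side_pos n (k j)]⟩

/-- Lines and half-lines `[0, ∞)` are closed under increasing a coordinate, so only the lower corner
matters. -/
theorem box_subset_domain_iff (hΩ : ∀ j, Ω j = Set.univ ∨ Ω j = Set.Ici 0) (n : ℤ) (a : ι → ℝ) :
    box k n a ⊆ domain Ω ↔ a ∈ domain Ω := by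
  refine ⟨fun h => h (mem_box_self n a), fun h x hx j _ => ?_⟩
  have h1 := h j trivial
  have h2 := hx j trivial
  rcases hΩ j with hj | hj
  · rw [hj]
    trivial
  · rw [hj] at h1 ⊢
    exact le_trans h1 h2.1

/-- The lower corner of the enlargement of a box. -/
noncomputable def enlargedCorner (Ω : ι → Set ℝ) (k : ι → ℕ) (n : ℤ) (a : ι → ℚ) (j : ι) : ℚ :=
  haveI := Classical.dec (Ω j = Set.univ)
  if Ω j = Set.univ then a j - 2 ^ (-(n * (k j : ℤ))) else max (a j - 2 ^ (-(n * (k j : ℤ)))) 0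

theorem enlargedCorner_mem (hΩ : ∀ j, Ω j = Set.univ ∨ Ω j = Set.Ici 0) (n : ℤ) (a : ι → ℚ) :
    (fun j => (enlargedCorner Ω k n a j : ℝ)) ∈ domain Ω := by
  intro j _
  dsimp only
  unfold enlargedCorner
  split_ifs with h
  · rw [h]
    trivial
  · rw [(hΩ j).resolve_left h]
    push_cast
    exact le_max_right (_ : ℝ) _

/-- Measurability of the maximal function calls for countably many boxes; this allows arbitrary
corners to be replaced by rational ones. A coordinate at the endpoint of a half-line cannot be
lowered, but 0 is itself rational. -/
theorem exists_rat_corner (hΩ : ∀ j, Ω j = Set.univ ∨ Ω j = Set.Ici 0) {a s : ι → ℝ}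
    (ha : a ∈ domain Ω) (hs : ∀ j, 0 < s j) :
    ∃ b : ι → ℚ, (fun j => (b j : ℝ)) ∈ domain Ω ∧ ∀ j, a j - s j ≤ b j ∧ (b j : ℝ) ≤ a j := by
  have key : ∀ j, ∃ r : ℚ, (r : ℝ) ∈ Ω j ∧ a j - s j ≤ r ∧ (r : ℝ) ≤ a j := by
    intro j
    have haj := ha j trivial
    rcases hΩ j with hj | hj
    · obtain ⟨r, h1, h2⟩ := exists_rat_btwn (show a j - s j < a j by linarith [hs j])
      exact ⟨r, by rw [hj]; trivial, h1.le, h2.le⟩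
    · rw [hj] at haj ⊢
      rcases (show 0 ≤ a j from haj).eq_or_lt with h0 | h0
      · exact ⟨0, by simp, by simpa [← h0] using (hs j).le, by simp [← h0]⟩
      · obtain ⟨r, h1, h2⟩ := exists_rat_btwn (show max (a j - s j) 0 < a j from
          max_lt (by linarith [hs j]) h0)
        exact ⟨r, (le_max_right _ _).trans h1.le, (le_max_left _ _).trans h1.le, h2.le⟩
  choose b hb using key
  exact ⟨b, fun j _ => (hb j).1, fun j => (hb j).2⟩

variable [Fintype ι]

theorem measurableSet_box (n : ℤ) (a : ι → ℝ) : MeasurableSet (box k n a) :=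
  MeasurableSet.univ_pi fun _ => measurableSet_Ico

theorem volume_box (n : ℤ) (a : ι → ℝ) :
    volume (box k n a) = ∏ j, ENNReal.ofReal (2 ^ (-(n * (k j : ℤ)))) := by
  rw [box, Real.volume_pi_Ico]
  simp

theorem volume_box_ne_zero (n : ℤ) (a : ι → ℝ) : volume (box k n a) ≠ 0 := by
  rw [volume_box]
  refine Finset.prod_ne_zero_iff.2 fun j _ => ?_
  simpa using side_pos n (k j)

theorem volume_box_ne_top (n : ℤ) (a : ι → ℝ) : volume (box k n a) ≠ ∞ := by
  rw [volume_box]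
  exact ENNReal.prod_ne_top fun j _ => ENNReal.ofReal_ne_top

/-- Side `j` grows by exactly 2^(r k(j)), whatever the generation, so the volume ratio depends only
on `r` and the sum of the `k j`. -/
theorem volume_box_sub (n : ℤ) (r : ℕ) (a b : ι → ℝ) :
    volume (box k (n - r) a) = ((2 : ℝ≥0∞) ^ r) ^ (∑ j, k j) * volume (box k n b) := by
  rw [volume_box, volume_box, ← Finset.prod_pow_eq_pow_sum, ← Finset.prod_mul_distrib]
  refine Finset.prod_congr rfl fun j _ => ?_
  rw [side_sub, ENNReal.ofReal_mul (by positivity), ENNReal.ofReal_pow (by positivity),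
    ENNReal.ofReal_pow (by positivity)]
  simp

/-- The boxes with rational corners in the domain. -/
abbrev BoxIndex (Ω : ι → Set ℝ) : Type _ :=
  {i : ℤ × (ι → ℚ) // (fun j => (i.2 j : ℝ)) ∈ domain Ω}

theorem restrict_domain_restrict_box (hΩ : ∀ j, Ω j = Set.univ ∨ Ω j = Set.Ici 0) {n : ℤ}
    {a : ι → ℝ} (ha : a ∈ domain Ω) :
    (volume.restrict (domain Ω)).restrict (box k n a) = volume.restrict (box k n a) :=
  Measure.restrict_restrict_of_subset ((box_subset_domain_iff hΩ n a).2 ha)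

theorem restrict_domain_box (hΩ : ∀ j, Ω j = Set.univ ∨ Ω j = Set.Ici 0) {n : ℤ}
    {a : ι → ℝ} (ha : a ∈ domain Ω) :
    volume.restrict (domain Ω) (box k n a) = volume (box k n a) := by
  rw [← Measure.restrict_apply_univ (μ := volume.restrict (domain Ω)),
    restrict_domain_restrict_box hΩ ha, Measure.restrict_apply_univ]

/-- The boxes with rational corners in the domain form a doubling basis. -/
noncomputable def boxBasis (hΩ : ∀ j, Ω j = Set.univ ∨ Ω j = Set.Ici 0) (hk : ∀ j, 1 ≤ k j)
    {D : ℝ≥0∞} (hD : 4 ^ (∑ j, k j) ≤ D) :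
    DoublingBasis (volume.restrict (domain Ω)) (BoxIndex Ω) D where
  carrier i := box k i.1.1 fun j => (i.1.2 j : ℝ)
  size i := 2 ^ (-i.1.1)
  enlarge i := ⟨(i.1.1 - 2, enlargedCorner Ω k i.1.1 i.1.2), enlargedCorner_mem hΩ _ _⟩
  measurableSet _ := measurableSet_box _ _
  size_nonneg _ := by positivity
  measure_ne_zero i := by
    rw [restrict_domain_box hΩ i.2]
    exact volume_box_ne_zero _ _
  measure_ne_top i := by
    rw [restrict_domain_box hΩ i.2]
    exact volume_box_ne_top _ _
  subset_enlarge := by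
    rintro ⟨⟨n, a⟩, ha⟩ ⟨⟨m, b⟩, hb⟩ ⟨x, hxa, hxb⟩ hsize y hy j -
    dsimp only at *
    -- Sizes are powers of two, so a ratio of at most 3/2 < 2 means that the first box is no larger
    -- than the second.
    have hnm : m ≤ n := by
      by_contra! hlt
      have h1 : (2 : ℝ) ^ (1 - m) ≤ 2 ^ (-n) := zpow_le_zpow_right₀ one_le_two (by omega)
      have h2 : (0 : ℝ) < 2 ^ (-m) := by positivity
      rw [sub_eq_add_neg, zpow_add₀ two_ne_zero, zpow_one] at h1
      linarith
    have hside := side_anti hnm (k j)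
    have hxaj := hxa j trivial
    have hxbj := hxb j trivial
    have hyj := hy j trivial
    have hyΩ := (box_subset_domain_iff hΩ n _).2 ha hy j trivial
    have hm := side_pos m (k j)
    -- If L is side `j` of the second box, the first box lies between `b j - L` and `b j + 2L` in
    -- this coordinate. An interval of length 3L suffices; two generations give at least 4L because
    -- `k j ≥ 1`.
    have hbig : 4 * (2 : ℝ) ^ (-(m * (k j : ℤ))) ≤ 2 ^ (-((m - 2) * (k j : ℤ))) := by
      have h4 : (4 : ℝ) ≤ (2 ^ 2) ^ k j := by
        calc (4 : ℝ) = (2 ^ 2) ^ 1 := by norm_num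
          _ ≤ (2 ^ 2) ^ k j := pow_le_pow_right₀ (by norm_num) (hk j)
      rw [show m - 2 = m - (2 : ℕ) by norm_num, side_sub]
      gcongr
    have hlow : (b j : ℝ) - 2 ^ (-(m * (k j : ℤ))) ≤ enlargedCorner Ω k m b j ∧
        (enlargedCorner Ω k m b j : ℝ) ≤ y j := by
      unfold enlargedCorner
      split_ifs with h
      · push_cast
        exact ⟨le_rfl, by linarith [hxaj.2, hxbj.1, hyj.1]⟩
      · rw [(hΩ j).resolve_left h] at hyΩ
        push_cast
        exact ⟨le_max_left (_ : ℝ) _, max_le (by linarith [hxaj.2, hxbj.1, hyj.1]) hyΩ⟩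
    exact ⟨hlow.2, by linarith [hxaj.1, hxbj.2, hyj.2, hlow.1]⟩
  measure_enlarge_le i := by
    rw [restrict_domain_box hΩ i.2, restrict_domain_box hΩ (enlargedCorner_mem hΩ _ _),
      show i.1.1 - 2 = i.1.1 - (2 : ℕ) by norm_num, volume_box_sub _ _ _ fun j => (i.1.2 j : ℝ)]
    gcongr
    refine le_trans (le_of_eq ?_) hD
    norm_num

/-- The `A_p` condition over all boxes in the domain, for an extended nonnegative weight. -/
def BoxAp (Ω : ι → Set ℝ) (k : ι → ℕ) (p : ℝ) (W : (ι → ℝ) → ℝ≥0∞) (K : ℝ≥0∞) : Prop :=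
  ∀ (n : ℤ) (a : ι → ℝ), a ∈ domain Ω → (∫⁻ x in box k n a, W x) *
    (∫⁻ x in box k n a, W x ^ (-1 / (p - 1))) ^ (p - 1) ≤ K * volume (box k n a) ^ p

theorem BoxAp.hasAp (hΩ : ∀ j, Ω j = Set.univ ∨ Ω j = Set.Ici 0) (hk : ∀ j, 1 ≤ k j)
    {D : ℝ≥0∞} (hD : 4 ^ (∑ j, k j) ≤ D) {p : ℝ} {W : (ι → ℝ) → ℝ≥0∞} {K : ℝ≥0∞}
    (h : BoxAp Ω k p W K) :
    HasAp (boxBasis hΩ hk hD).carrier (volume.restrict (domain Ω)) p W K := by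
  intro i
  have := h i.1.1 (fun j => (i.1.2 j : ℝ)) i.2
  simp only [boxBasis]
  rwa [restrict_domain_restrict_box hΩ i.2, restrict_domain_box hΩ i.2]

/-- Any box lies in a box with rational corner one generation coarser, of volume at most `D` times
as large; the power `p` of the volume in the A_p condition yields the factor `D ^ p`. -/
theorem HasAp.boxAp (hΩ : ∀ j, Ω j = Set.univ ∨ Ω j = Set.Ici 0) (hk : ∀ j, 1 ≤ k j)
    {D : ℝ≥0∞} (hD : 4 ^ (∑ j, k j) ≤ D) {p : ℝ} (hp : 1 < p) {W : (ι → ℝ) → ℝ≥0∞} {K : ℝ≥0∞}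
    (h : HasAp (boxBasis hΩ hk hD).carrier (volume.restrict (domain Ω)) p W K) :
    BoxAp Ω k p W (K * D ^ p) := by
  intro n a ha
  have hp1 : 0 ≤ p - 1 := by linarith
  obtain ⟨b, hb, hab⟩ := exists_rat_corner hΩ ha fun j => side_pos n (k j)
  have hsub : box k n a ⊆ box k (n - 1) fun j => (b j : ℝ) := by
    intro x hx j _
    have hxj := hx j trivial
    have hbig : 2 * (2 : ℝ) ^ (-(n * (k j : ℤ))) ≤ 2 ^ (-((n - 1) * (k j : ℤ))) := by
      have h2 : (2 : ℝ) ≤ (2 ^ 1) ^ k j := by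
        calc (2 : ℝ) = (2 ^ 1) ^ 1 := by norm_num
          _ ≤ (2 ^ 1) ^ k j := pow_le_pow_right₀ (by norm_num) (hk j)
      rw [show n - 1 = n - (1 : ℕ) by norm_num, side_sub]
      gcongr
    exact ⟨(hab j).2.trans hxj.1, by linarith [(hab j).1, hxj.2]⟩
  have hi := h ⟨(n - 1, b), hb⟩
  simp only [boxBasis] at hi
  rw [restrict_domain_restrict_box hΩ hb, restrict_domain_box hΩ hb] at hi
  calc _ ≤ _ := by
        gcongr ?_ * ?_ ^ (p - 1)
        · exact lintegral_mono_set hsub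
        · exact lintegral_mono_set hsub
    _ ≤ _ := hi
    _ ≤ K * (D * volume (box k n a)) ^ p := by
        gcongr
        rw [show n - 1 = n - (1 : ℕ) by norm_num, volume_box_sub _ _ _ a]
        gcongr
        refine le_trans ?_ hD
        gcongr
        norm_num
    _ = _ := by rw [ENNReal.mul_rpow_of_nonneg _ _ (by linarith), mul_assoc]

/-- Extrapolation from `L_p` to `L_q` for weights on the product domain. -/
theorem lpNormW_le_of_forall_boxAp (hΩ : ∀ j, Ω j = Set.univ ∨ Ω j = Set.Ici 0)
    (hk : ∀ j, 1 ≤ k j) {D : ℝ≥0∞} (hD : 4 ^ (∑ j, k j) ≤ D) (hDt : D ≠ ∞) {p q : ℝ}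
    (hp : 1 < p) (hq : 1 < q) {K : ℝ≥0∞} (hK : K ≠ ∞) {W : (ι → ℝ) → ℝ≥0∞} (hW : IsPosWeight W)
    (hWA : BoxAp Ω k q W K) {U G : (ι → ℝ) → ℝ≥0∞} (hU : Measurable U) (hG : Measurable G)
    {N : ℝ≥0∞} (hN0 : N ≠ 0) (hN : N ≠ ∞)
    (H : ∀ V : (ι → ℝ) → ℝ≥0∞, IsPosWeight V →
      BoxAp Ω k p V (extrapolationConst p q D K * D ^ p) →
      lpNormW (volume.restrict (domain Ω)) p V U ≤
        N * lpNormW (volume.restrict (domain Ω)) p V G) :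
    lpNormW (volume.restrict (domain Ω)) q W U ≤
      4 * N * lpNormW (volume.restrict (domain Ω)) q W G :=
  lpNormW_le_of_forall_weight (boxBasis hΩ hk hD) hp hq hDt hK hW (hWA.hasAp hΩ hk hD) hU hG hN0 hN
    fun V hV hVA => H V hV (hVA.boxAp hΩ hk hD hp)

end Boxes

/-! ### Splitting the variables: Tonelli's theorem and product weights -/

section Marginals

variable {ι : Type*} {s t T : Finset ι}

/-- The restriction to `s` of a family indexed by `T ⊇ s`. -/
def subRestrict (h : s ⊆ T) (y : T → ℝ) (j : s) : ℝ := y ⟨j, h j.2⟩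

theorem measurable_subRestrict (h : s ⊆ T) : Measurable (subRestrict h) :=
  measurable_pi_lambda _ fun _ => measurable_pi_apply _

theorem IsPosWeight.mul_restrict (hs : s ⊆ T) (ht : t ⊆ T) {f : (s → ℝ) → ℝ≥0∞}
    (hf : IsPosWeight f) {V : (t → ℝ) → ℝ≥0∞} (hV : IsPosWeight V) :
    IsPosWeight fun y : T → ℝ => f (subRestrict hs y) * V (subRestrict ht y) :=
  ⟨(hf.measurable.comp (measurable_subRestrict hs)).mul
    (hV.measurable.comp (measurable_subRestrict ht)),
    fun _ => mul_ne_zero (hf.ne_zero _) (hV.ne_zero _),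
    fun _ => ENNReal.mul_ne_top (hf.ne_top _) (hV.ne_top _)⟩

variable [DecidableEq ι]

theorem restrict_updateFinset_self (x : ι → ℝ) (y : s → ℝ) :
    s.restrict (Function.updateFinset x s y) = y := by
  ext j
  simp [Function.updateFinset]

theorem restrict_updateFinset_of_subset (h : s ⊆ T) (x : ι → ℝ) (y : T → ℝ) :
    s.restrict (Function.updateFinset x T y) = subRestrict h y := by
  ext j
  simp [Function.updateFinset, subRestrict, h j.2]

theorem restrict_updateFinset_of_disjoint (h : Disjoint s t) (x : ι → ℝ) (y : s → ℝ) :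
    t.restrict (Function.updateFinset x s y) = t.restrict x := by
  ext j
  simp [Function.updateFinset, Finset.disjoint_right.1 h j.2]

/-- Tonelli's theorem for the splitting of the variables in `T` into those in `s` and in `t`. -/
theorem lintegral_mul_restrict_eq (μ : ι → Measure ℝ) [∀ j, SigmaFinite (μ j)]
    (hT : T = t ∪ s) (hst : Disjoint s t) (ht : t ⊆ T) {Φ : (ι → ℝ) → ℝ≥0∞} (hΦ : Measurable Φ)
    {V : (t → ℝ) → ℝ≥0∞} (hV : Measurable V) :
    ∫⁻ y : T → ℝ, Φ (Function.updateFinset 0 T y) * V (subRestrict ht y)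
        ∂Measure.pi (fun j : T => μ j) =
      ∫⁻ z : t → ℝ, lmarginal μ s Φ (Function.updateFinset 0 t z) * V z
        ∂Measure.pi (fun j : t => μ j) := by
  subst hT
  have hVr : Measurable fun x : ι → ℝ => V (t.restrict x) := hV.comp (Finset.measurable_restrict t)
  calc _ = lmarginal μ (t ∪ s) (fun x => Φ x * V (t.restrict x)) 0 := by
        rw [lmarginal]
        refine lintegral_congr fun y => ?_
        rw [restrict_updateFinset_of_subset ht]
    _ = lmarginal μ t (lmarginal μ s (fun x => Φ x * V (t.restrict x))) 0 := by
        rw [lmarginal_union μ (fun x => Φ x * V (t.restrict x)) (hΦ.mul hVr) hst.symm]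
    _ = _ := by
        rw [lmarginal]
        refine lintegral_congr fun z => ?_
        rw [lmarginal]
        simp_rw [restrict_updateFinset_of_disjoint hst, restrict_updateFinset_self]
        have hm : Measurable fun y =>
            Φ (Function.updateFinset (Function.updateFinset 0 t z) s y) :=
          hΦ.comp measurable_updateFinset
        rw [lintegral_mul_const _ hm, lmarginal]

theorem lintegral_restrict_mul_restrict_eq (μ : ι → Measure ℝ) [∀ j, SigmaFinite (μ j)]
    (hT : T = t ∪ s) (hst : Disjoint s t) (hs : s ⊆ T) (ht : t ⊆ T) {f : (s → ℝ) → ℝ≥0∞}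
    (hf : Measurable f) {V : (t → ℝ) → ℝ≥0∞} (hV : Measurable V) :
    ∫⁻ y : T → ℝ, f (subRestrict hs y) * V (subRestrict ht y)
        ∂Measure.pi (fun j : T => μ j) =
      (∫⁻ z, f z ∂Measure.pi (fun j : s => μ j)) * ∫⁻ z, V z ∂Measure.pi (fun j : t => μ j) := by
  have h := lintegral_mul_restrict_eq μ hT hst ht (Φ := fun x => f (s.restrict x))
    (hf.comp (Finset.measurable_restrict s)) hV
  simp_rw [restrict_updateFinset_of_subset hs, lmarginal, restrict_updateFinset_self] at h
  rw [h, lintegral_const_mul _ hV]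

theorem mem_box_iff_restrict {k : ι → ℕ} (hT : T = t ∪ s) (hs : s ⊆ T) (ht : t ⊆ T) (n : ℤ)
    (a y : T → ℝ) :
    y ∈ box (fun j : T => k j) n a ↔
      subRestrict hs y ∈ box (fun j : s => k j) n (subRestrict hs a) ∧
      subRestrict ht y ∈ box (fun j : t => k j) n (subRestrict ht a) := by
  constructor
  · exact fun h => ⟨fun j _ => h ⟨j, hs j.2⟩ trivial, fun j _ => h ⟨j, ht j.2⟩ trivial⟩
  · rintro ⟨h1, h2⟩ ⟨j, hj⟩ -
    have hj' := hj
    rw [hT, Finset.mem_union] at hj'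
    rcases hj' with h | h
    · exact h2 ⟨j, h⟩ trivial
    · exact h1 ⟨j, h⟩ trivial

theorem setLIntegral_box_mul_eq {k : ι → ℕ} (hT : T = t ∪ s) (hst : Disjoint s t)
    (hs : s ⊆ T) (ht : t ⊆ T) {f : (s → ℝ) → ℝ≥0∞} (hf : Measurable f) {V : (t → ℝ) → ℝ≥0∞}
    (hV : Measurable V) (n : ℤ) (a : T → ℝ) :
    ∫⁻ y in box (fun j : T => k j) n a, f (subRestrict hs y) * V (subRestrict ht y) =
      (∫⁻ z in box (fun j : s => k j) n (subRestrict hs a), f z) *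
        ∫⁻ z in box (fun j : t => k j) n (subRestrict ht a), V z := by
  have hbs := measurableSet_box (k := fun j : s => k j) n (subRestrict hs a)
  have hbt := measurableSet_box (k := fun j : t => k j) n (subRestrict ht a)
  rw [← lintegral_indicator (measurableSet_box _ _), ← lintegral_indicator hbs,
    ← lintegral_indicator hbt]
  refine Eq.trans ?_ (lintegral_restrict_mul_restrict_eq (fun _ => volume) hT hst hs ht
    (hf.indicator hbs) (hV.indicator hbt))
  refine lintegral_congr fun y => ?_
  have hmem := mem_box_iff_restrict (k := k) hT hs ht n a y
  by_cases h1 : subRestrict hs y ∈ box (fun j : s => k j) n (subRestrict hs a)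
  · by_cases h2 : subRestrict ht y ∈ box (fun j : t => k j) n (subRestrict ht a)
    · rw [Set.indicator_of_mem h1, Set.indicator_of_mem h2, Set.indicator_of_mem (hmem.2 ⟨h1, h2⟩)]
    · rw [Set.indicator_of_notMem h2, mul_zero, Set.indicator_of_notMem fun h => h2 (hmem.1 h).2]
  · rw [Set.indicator_of_notMem h1, zero_mul, Set.indicator_of_notMem fun h => h1 (hmem.1 h).1]

/-- The product of `A_p` weights in separate groups of variables is an `A_p` weight. -/
theorem BoxAp.mul_restrict {k : ι → ℕ} {Ω : ι → Set ℝ} (hT : T = t ∪ s) (hst : Disjoint s t)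
    (hs : s ⊆ T) (ht : t ⊆ T) {p : ℝ} (hp : 1 < p) {f : (s → ℝ) → ℝ≥0∞} (hf : IsPosWeight f)
    {V : (t → ℝ) → ℝ≥0∞} (hV : IsPosWeight V) {K L : ℝ≥0∞}
    (hfA : BoxAp (fun j : s => Ω j) (fun j : s => k j) p f K)
    (hVA : BoxAp (fun j : t => Ω j) (fun j : t => k j) p V L) :
    BoxAp (fun j : T => Ω j) (fun j : T => k j) p
      (fun y => f (subRestrict hs y) * V (subRestrict ht y)) (K * L) := by
  intro n a ha
  have hp1 : 0 ≤ p - 1 := by linarith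
  have h1 := hfA n (subRestrict hs a) fun j _ => ha ⟨j, hs j.2⟩ trivial
  have h2 := hVA n (subRestrict ht a) fun j _ => ha ⟨j, ht j.2⟩ trivial
  have hvol : volume (box (fun j : T => k j) n a) =
      volume (box (fun j : s => k j) n (subRestrict hs a)) *
        volume (box (fun j : t => k j) n (subRestrict ht a)) := by
    have := setLIntegral_box_mul_eq (k := k) hT hst hs ht (f := fun _ => 1) measurable_const
      (V := fun _ => 1) measurable_const n a
    simpa using this
  have hpow : ∀ y : T → ℝ, (f (subRestrict hs y) * V (subRestrict ht y)) ^
      (-1 / (p - 1)) = f (subRestrict hs y) ^ (-1 / (p - 1)) *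
        V (subRestrict ht y) ^ (-1 / (p - 1)) := fun y =>
    ENNReal.mul_rpow_of_ne_top (hf.ne_top _) (hV.ne_top _) _
  simp_rw [hpow]
  rw [setLIntegral_box_mul_eq hT hst hs ht hf.measurable hV.measurable,
    setLIntegral_box_mul_eq hT hst hs ht (hf.rpow _).measurable (hV.rpow _).measurable, hvol,
    ENNReal.mul_rpow_of_nonneg _ _ hp1, ENNReal.mul_rpow_of_nonneg _ _ (by linarith),
    mul_mul_mul_comm, mul_mul_mul_comm K]
  exact mul_le_mul' h1 h2

theorem boxAp_one {κ : Type*} [Fintype κ] (Ω : κ → Set ℝ) (k : κ → ℕ) {p : ℝ} (hp : 1 < p) :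
    BoxAp Ω k p (fun _ => 1) 1 := by
  intro n a _
  simp only [ENNReal.one_rpow, setLIntegral_one, one_mul]
  refine le_of_eq ?_
  nth_rw 1 [← ENNReal.rpow_one (volume (box k n a))]
  rw [← ENNReal.rpow_add_of_nonneg _ _ zero_le_one (by linarith)]
  congr 1
  ring

theorem restrict_domain_eq_pi {κ : Type*} [Fintype κ] (Ω : κ → Set ℝ) :
    (volume : Measure (κ → ℝ)).restrict (domain Ω) =
      Measure.pi fun j => (volume : Measure ℝ).restrict (Ω j) := by
  rw [domain, volume_pi, Measure.restrict_pi_pi]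

/-- A property that holds almost everywhere holds almost everywhere on almost every slice. -/
theorem ae_ae_updateFinset [Fintype ι] (μ : ι → Measure ℝ) [∀ j, SigmaFinite (μ j)] (s : Finset ι)
    {P : (ι → ℝ) → Prop} (h : ∀ᵐ x ∂Measure.pi μ, P x) :
    ∀ᵐ x ∂Measure.pi μ, ∀ᵐ y ∂Measure.pi (fun j : s => μ j), P (Function.updateFinset x s y) := by
  obtain ⟨E, hPE, hE, hE0⟩ := exists_measurable_superset_of_null h
  set f : (ι → ℝ) → ℝ≥0∞ := E.indicator 1
  have hf : Measurable f := measurable_one.indicator hE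
  have hz : ∫⁻ x, lmarginal μ s f x ∂Measure.pi μ = 0 := by
    have hmf : Measurable (lmarginal μ s f) := hf.lmarginal μ
    have h1 : ∀ F : (ι → ℝ) → ℝ≥0∞, Measurable F →
        lmarginal μ sᶜ (lmarginal μ s F) = fun _ => ∫⁻ x, F x ∂Measure.pi μ := by
      intro F hF
      rw [← lmarginal_union μ F hF disjoint_compl_left, Finset.union_comm, Finset.union_compl,
        lmarginal_univ]
    have h0 : ∫⁻ x, f x ∂Measure.pi μ = 0 := by
      rw [lintegral_indicator_one hE, hE0]
    -- The marginal over `s` is integrated over all variables, including those of `s` a second time.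
    -- The factor so gained may be infinite, but it multiplies the integral of `f`, which is zero.
    have h2 : lmarginal μ s (lmarginal μ sᶜ (lmarginal μ s f)) = fun _ => 0 := by
      rw [h1 f hf, h0]
      ext x
      simp [lmarginal]
    rw [← lmarginal_union μ _ hmf disjoint_compl_right, Finset.union_compl, lmarginal_univ] at h2
    exact congrFun h2 0
  rw [lintegral_eq_zero_iff (hf.lmarginal μ)] at hz
  filter_upwards [hz] with x hx
  have hx' : ∫⁻ y, f (Function.updateFinset x s y) ∂Measure.pi (fun j : s => μ j) = 0 := hx
  have hfx : Measurable fun y => f (Function.updateFinset x s y) :=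
    hf.comp measurable_updateFinset
  rw [lintegral_eq_zero_iff hfx] at hx'
  filter_upwards [hx'] with y hy
  by_contra hP
  have : Function.updateFinset x s y ∈ E := hPE hP
  simp [f, this] at hy

end Marginals

/-! ### Mixed norms and induction over the blocks -/

section Blocks

variable {d m : ℕ}

/-- The coordinates that are not in the first `i` blocks. -/
def tail (l : Fin (m + 1) → ℕ) (i : Fin (m + 1)) : Finset (Fin d) :=
  Finset.univ.filter fun j => l i ≤ (j : ℕ)

theorem tail_castSucc {l : Fin (m + 1) → ℕ} (hl : StrictMono l) (i : Fin m) :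
    tail (d := d) l i.castSucc = tail l i.succ ∪ block l i := by
  ext j
  have := hl i.castSucc_lt_succ
  simp only [tail, block, Finset.mem_filter, Finset.mem_univ, true_and, Finset.mem_union]
  omega

theorem disjoint_block_tail (l : Fin (m + 1) → ℕ) (i : Fin m) :
    Disjoint (block (d := d) l i) (tail l i.succ) := by
  rw [Finset.disjoint_left]
  intro j h1 h2
  simp only [tail, block, Finset.mem_filter, Finset.mem_univ, true_and] at h1 h2
  omega

theorem tail_zero {l : Fin (m + 1) → ℕ} (h : l 0 = 0) : tail (d := d) l 0 = Finset.univ := by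
  simp [tail, h]

theorem tail_last {l : Fin (m + 1) → ℕ} (h : l (Fin.last m) = d) :
    tail (d := d) l (Fin.last m) = ∅ := by
  ext j
  simp [tail, h]

variable {Ω : Fin d → Set ℝ} {l : Fin (m + 1) → ℕ} {p : Fin m → ℝ}
  {w : (i : Fin m) → ((block (d := d) l i) → ℝ) → ℝ}

theorem partialMixedNorm_succ (Ω : Fin d → Set ℝ) (p : Fin m → ℝ)
    (w : (i : Fin m) → ((block (d := d) l i) → ℝ) → ℝ) (f : (Fin d → ℝ) → ℝ)
    (i : Fin m) (x : Fin d → ℝ) :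
    partialMixedNorm Ω l p w f i.succ x =
      (lmarginal (fun j => (volume : Measure ℝ).restrict (Ω j)) (block l i)
        (fun y => partialMixedNorm Ω l p w f i.castSucc y ^ p i *
          ENNReal.ofReal (w i ((block l i).restrict y))) x) ^ (1 / p i) := rfl

theorem measurable_partialMixedNorm (hw : ∀ i, Measurable (w i)) {f : (Fin d → ℝ) → ℝ}
    (hf : Measurable f) (i : Fin (m + 1)) : Measurable (partialMixedNorm Ω l p w f i) := by
  induction i using Fin.induction with
  | zero => exact hf.enorm
  | succ i ih =>
    refine Measurable.pow_const (Measurable.lmarginal _ ?_) _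
    exact (ih.pow_const _).mul
      ((hw i).comp (Finset.measurable_restrict _)).ennreal_ofReal

/-- The mixed norm depends only on almost-everywhere classes. -/
theorem ae_partialMixedNorm_eq {w' : (i : Fin m) → ((block (d := d) l i) → ℝ) → ℝ}
    (hw : ∀ i, ∀ᵐ y ∂Measure.pi (fun j : block (d := d) l i => volume.restrict (Ω j)),
      w i y = w' i y) {f f' : (Fin d → ℝ) → ℝ}
    (hf : ∀ᵐ x ∂Measure.pi (fun j => (volume : Measure ℝ).restrict (Ω j)), f x = f' x)
    (i : Fin (m + 1)) :
    ∀ᵐ x ∂Measure.pi (fun j => (volume : Measure ℝ).restrict (Ω j)),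
      partialMixedNorm Ω l p w f i x = partialMixedNorm Ω l p w' f' i x := by
  induction i using Fin.induction with
  | zero =>
    filter_upwards [hf] with x hx
    simp [partialMixedNorm, hx]
  | succ i ih =>
    filter_upwards [ae_ae_updateFinset _ (block l i) ih] with x hx
    rw [partialMixedNorm_succ, partialMixedNorm_succ]
    congr 1
    refine lintegral_congr_ae ?_
    filter_upwards [hx, hw i] with y hy1 hy2
    rw [hy1, restrict_updateFinset_self, hy2]

/-- The mixed norm is evaluated at the single point 0, about which an almost-everywhere statement
says nothing. Independence of the integrated coordinates allows 0 to be replaced by a generic point.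
-/
theorem partialMixedNorm_congr (hl : StrictMono l) (h0 : l 0 = 0) (f : (Fin d → ℝ) → ℝ)
    (i : Fin (m + 1)) {x y : Fin d → ℝ} (hxy : ∀ j ∈ tail l i, x j = y j) :
    partialMixedNorm Ω l p w f i x = partialMixedNorm Ω l p w f i y := by
  induction i using Fin.induction generalizing x y with
  | zero =>
    rw [tail_zero h0] at hxy
    rw [show x = y from funext fun j => hxy j (Finset.mem_univ j)]
  | succ i ih =>
    rw [partialMixedNorm_succ, partialMixedNorm_succ]
    congr 1
    refine lintegral_congr fun z => ?_
    dsimp only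
    rw [restrict_updateFinset_self, restrict_updateFinset_self]
    congr 2
    refine ih fun j hj => ?_
    by_cases hjb : j ∈ block l i
    · simp [Function.updateFinset, hjb]
    · rw [tail_castSucc hl, Finset.mem_union] at hj
      simp [Function.updateFinset, hjb, hxy j (hj.resolve_right hjb)]

theorem mixedNorm_eq_of_ae {w' : (i : Fin m) → ((block (d := d) l i) → ℝ) → ℝ}
    (hΩ : ∀ j, Ω j = Set.univ ∨ Ω j = Set.Ici 0) (hl : StrictMono l) (h0 : l 0 = 0)
    (hd : l (Fin.last m) = d)
    (hw : ∀ i, ∀ᵐ y ∂Measure.pi (fun j : block (d := d) l i => volume.restrict (Ω j)),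
      w i y = w' i y) {f f' : (Fin d → ℝ) → ℝ}
    (hf : ∀ᵐ x ∂Measure.pi (fun j => (volume : Measure ℝ).restrict (Ω j)), f x = f' x) :
    mixedNorm Ω l p w f = mixedNorm Ω l p w' f' := by
  -- A set of full measure contains a point only if the measure is nonzero; the unit box at the
  -- origin lies in every admissible domain.
  have hne : Measure.pi (fun j => (volume : Measure ℝ).restrict (Ω j)) ≠ 0 := by
    intro h
    have h1 := volume_box_ne_zero (k := fun _ : Fin d => 1) 0 0
    rw [← restrict_domain_box (Ω := Ω) hΩ, restrict_domain_eq_pi, h] at h1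
    · exact h1 rfl
    · intro j _
      rcases hΩ j with hj | hj <;> rw [hj] <;> simp
  have : (ae (Measure.pi (fun j => (volume : Measure ℝ).restrict (Ω j)))).NeBot := ae_neBot.2 hne
  obtain ⟨x, hx⟩ := (ae_partialMixedNorm_eq (p := p) hw hf (Fin.last m)).exists
  have hxy : ∀ j ∈ tail l (Fin.last m), (0 : Fin d → ℝ) j = x j := by
    rw [tail_last hd]
    simp
  rw [mixedNorm, mixedNorm, partialMixedNorm_congr hl h0 f _ hxy,
    partialMixedNorm_congr hl h0 f' _ hxy, hx]

/-- Integrating out one block turns the weighted norm over the coordinates beyond the first `i`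
blocks, for a product weight, into the one beyond the first `i + 1` blocks. -/
theorem lpNormW_partialMixedNorm_castSucc (hl : StrictMono l) (hp : ∀ i, 1 < p i)
    (hw : ∀ i, Measurable (w i)) {f : (Fin d → ℝ) → ℝ} (hf : Measurable f) (i : Fin m)
    (hs : block l i ⊆ tail (d := d) l i.castSucc) (ht : tail l i.succ ⊆ tail (d := d) l i.castSucc)
    {V : (tail (d := d) l i.succ → ℝ) → ℝ≥0∞} (hV : Measurable V) :
    lpNormW (volume.restrict (domain fun j : tail (d := d) l i.castSucc => Ω j)) (p i)
        (fun y => ENNReal.ofReal (w i (subRestrict hs y)) * V (subRestrict ht y))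
        (fun y => partialMixedNorm Ω l p w f i.castSucc (Function.updateFinset 0 _ y)) =
      lpNormW (volume.restrict (domain fun j : tail (d := d) l i.succ => Ω j)) (p i) V
        (fun y => partialMixedNorm Ω l p w f i.succ (Function.updateFinset 0 _ y)) := by
  have hpi : 0 < p i := by linarith [hp i]
  unfold lpNormW
  congr 1
  rw [restrict_domain_eq_pi, restrict_domain_eq_pi]
  -- In the exponent `p i`, the integral over the block is exactly the `p i`-th power of the next
  -- partial norm.
  have h := lintegral_mul_restrict_eq (fun j => (volume : Measure ℝ).restrict (Ω j))
    (tail_castSucc hl i) (disjoint_block_tail l i) ht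
    (Φ := fun y => partialMixedNorm Ω l p w f i.castSucc y ^ p i *
          ENNReal.ofReal (w i ((block l i).restrict y)))
    (((measurable_partialMixedNorm hw hf _).pow_const _).mul
      ((hw i).comp (Finset.measurable_restrict _)).ennreal_ofReal) hV
  refine Eq.trans (lintegral_congr fun y => ?_) (h.trans (lintegral_congr fun z => ?_))
  · rw [restrict_updateFinset_of_subset hs, mul_assoc]
  · dsimp only
    rw [partialMixedNorm_succ, ← ENNReal.rpow_mul, one_div_mul_cancel hpi.ne', ENNReal.rpow_one]

/-- The exponent in which the first `i` blocks are estimated before extrapolating to `p i`. -/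
def startExponent (hm : 0 < m) (p : Fin m → ℝ) : Fin (m + 1) → ℝ :=
  Fin.cases (p ⟨0, hm⟩) p

theorem one_lt_startExponent (hm : 0 < m) (hp : ∀ i, 1 < p i) (i : Fin (m + 1)) :
    1 < startExponent hm p i := by
  induction i using Fin.cases with
  | zero => exact hp _
  | succ i => exact hp i

/-- One doubling constant thus serves all groups of coordinates, which makes the final constants
independent of the partition. -/
theorem sum_tail_le (k : Fin d → ℕ) (T : Finset (Fin d)) :
    (4 : ℝ≥0∞) ^ (∑ j : T, k j) ≤ 4 ^ (∑ j, k j) := by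
  refine pow_le_pow_right₀ (by norm_num) ?_
  rw [Finset.sum_coe_sort T k]
  exact Finset.sum_le_sum_of_subset (Finset.subset_univ T)

/-- Weighted estimates in the coordinates beyond the first `i` blocks imply the mixed-norm
estimate. -/
theorem exists_const_mixedNorm_le (hm : 0 < m) (hp : ∀ i, 1 < p i) {k : Fin d → ℕ}
    (hk : ∀ j, 1 ≤ k j) {K : ℝ≥0∞} (hK : K ≠ ∞) (i : Fin (m + 1)) :
    ∃ Λ : ℝ≥0∞, Λ ≠ ∞ ∧ ∀ N : ℝ≥0∞, N ≠ 0 → N ≠ ∞ → ∃ N' : ℝ≥0∞, N' ≠ 0 ∧ N' ≠ ∞ ∧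
      ∀ (Ω : Fin d → Set ℝ), (∀ j, Ω j = Set.univ ∨ Ω j = Set.Ici 0) →
      ∀ (l : Fin (m + 1) → ℕ), StrictMono l → l (Fin.last m) = d →
      ∀ (w : (i : Fin m) → ((block (d := d) l i) → ℝ) → ℝ), (∀ i, Measurable (w i)) →
        (∀ i x, 0 < w i x) →
        (∀ i, BoxAp (fun j : block (d := d) l i => Ω j) (fun j => k j) (p i)
          (fun x => ENNReal.ofReal (w i x)) K) →
      ∀ (u g : (Fin d → ℝ) → ℝ), Measurable u → Measurable g →
        (∀ V : (tail (d := d) l i → ℝ) → ℝ≥0∞, IsPosWeight V →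
          BoxAp (fun j : tail (d := d) l i => Ω j) (fun j => k j) (startExponent hm p i) V Λ →
          lpNormW (volume.restrict (domain fun j : tail (d := d) l i => Ω j))
              (startExponent hm p i) V
              (fun y => partialMixedNorm Ω l p w u i (Function.updateFinset 0 _ y)) ≤
            N * lpNormW (volume.restrict (domain fun j : tail (d := d) l i => Ω j))
              (startExponent hm p i) V
              (fun y => partialMixedNorm Ω l p w g i (Function.updateFinset 0 _ y))) →
        mixedNorm Ω l p w u ≤ N' * mixedNorm Ω l p w g := by
  induction i using Fin.reverseInduction with
  | last =>
    -- No coordinates remain: the space is one point of mass 1, and the weight 1, of characteristic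
    -- at most 1, returns the mixed norm itself in any exponent.
    refine ⟨1, by simp, fun N hN0 hN => ⟨N, hN0, hN, ?_⟩⟩
    intro Ω hΩ l hl hd w hwm hw0 hwA u g hu hg H
    have hr := one_lt_startExponent hm hp (Fin.last m)
    have h := H (fun _ => 1) ⟨measurable_const, by simp, by simp⟩ (boxAp_one _ _ hr)
    have hnorm : ∀ f : (Fin d → ℝ) → ℝ,
        lpNormW (volume.restrict (domain fun j : tail (d := d) l (Fin.last m) => Ω j))
          (startExponent hm p (Fin.last m)) (fun _ => 1)
          (fun y => partialMixedNorm Ω l p w f (Fin.last m) (Function.updateFinset 0 _ y)) =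
        mixedNorm Ω l p w f := by
      intro f
      have hempty : IsEmpty (tail (d := d) l (Fin.last m)) := by
        rw [tail_last hd]
        infer_instance
      have hpt : ∀ y : tail (d := d) l (Fin.last m) → ℝ,
          Function.updateFinset (0 : Fin d → ℝ) _ y = 0 := by
        intro y
        ext j
        have : j ∉ tail l (Fin.last m) := by simp [tail_last hd]
        simp [Function.updateFinset, this]
      have hr0 : startExponent hm p (Fin.last m) ≠ 0 := by linarith
      simp_rw [lpNormW, hpt, mul_one]
      rw [restrict_domain_eq_pi, Measure.pi_of_empty, lintegral_const, measure_univ, mul_one,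
        ← ENNReal.rpow_mul, mul_one_div_cancel hr0, ENNReal.rpow_one, mixedNorm]
    rwa [hnorm, hnorm] at h
  | cast i ih =>
    obtain ⟨Λ, hΛ, H⟩ := ih
    have hr := one_lt_startExponent hm hp i.castSucc
    set r := startExponent hm p i.castSucc
    set D : ℝ≥0∞ := 4 ^ (∑ j, k j)
    have hDt : D ≠ ∞ := ENNReal.pow_ne_top (by simp)
    have hKΛ : K * Λ ≠ ∞ := ENNReal.mul_ne_top hK hΛ
    -- The product of `w i` and a weight of characteristic at most `Λ` has characteristic at most `K
    -- * Λ`; this is what extrapolation to `p i` then requires in exponent `r`, with `D ^ r` for the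
    -- passage to real corners.
    refine ⟨extrapolationConst r (p i) D (K * Λ) * D ^ r, ENNReal.mul_ne_top
      (extrapolationConst_ne_top hr (hp i) hDt hKΛ)
      (ENNReal.rpow_ne_top_of_nonneg (by linarith) hDt), fun N hN0 hN => ?_⟩
    obtain ⟨N', hN'0, hN', H'⟩ := H (4 * N) (mul_ne_zero (by simp) hN0)
      (ENNReal.mul_ne_top (by simp) hN)
    refine ⟨N', hN'0, hN', ?_⟩
    intro Ω hΩ l hl hd w hwm hw0 hwA u g hu hg hyp
    refine H' Ω hΩ l hl hd w hwm hw0 hwA u g hu hg fun V hV hVA => ?_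
    -- The starting exponent of stage `i.succ` is `p i` by definition. For the first block the
    -- exponent does not change, and the extrapolation step is merely uniform bookkeeping.
    change BoxAp _ _ (p i) V Λ at hVA
    change lpNormW _ (p i) V _ ≤ 4 * N * lpNormW _ (p i) V _
    have hT := tail_castSucc (d := d) hl i
    have hs : block l i ⊆ tail (d := d) l i.castSucc := by
      rw [hT]
      exact Finset.subset_union_right
    have ht : tail l i.succ ⊆ tail (d := d) l i.castSucc := by
      rw [hT]
      exact Finset.subset_union_left
    have hW : IsPosWeight fun x => ENNReal.ofReal (w i x) :=
      ⟨(hwm i).ennreal_ofReal, fun x => by simpa using hw0 i x, fun x => ENNReal.ofReal_ne_top⟩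
    have hmeas : ∀ {f : (Fin d → ℝ) → ℝ}, Measurable f →
        Measurable fun y : tail (d := d) l i.castSucc → ℝ =>
          partialMixedNorm Ω l p w f i.castSucc (Function.updateFinset 0 _ y) := fun hf =>
      (measurable_partialMixedNorm hwm hf _).comp measurable_updateFinset
    have key := lpNormW_le_of_forall_boxAp (Ω := fun j : tail (d := d) l i.castSucc => Ω j)
      (k := fun j => k j) (fun j => hΩ j) (fun j => hk j) (sum_tail_le k _) hDt hr (hp i) hKΛ
      (hW.mul_restrict hs ht hV)
      (BoxAp.mul_restrict hT (disjoint_block_tail l i) hs ht (hp i) hW hV (hwA i) hVA)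
      (hmeas hu) (hmeas hg) hN0 hN hyp
    rwa [lpNormW_partialMixedNorm_castSucc hl hp hwm hu i hs ht hV.measurable,
      lpNormW_partialMixedNorm_castSucc hl hp hwm hg i hs ht hV.measurable] at key

end Blocks

/-! ### Translation between real-valued weights and the extended-valued formulation -/

section Transfer

/-- Clearing denominators by v^p = v · v^(p-1) links averages over boxes with integrals. -/
theorem div_mul_div_rpow_le_iff {A B v K : ℝ≥0∞} {p : ℝ} (hp : 1 < p) (hv0 : v ≠ 0)
    (hvt : v ≠ ∞) : A / v * (B / v) ^ (p - 1) ≤ K ↔ A * B ^ (p - 1) ≤ K * v ^ p := by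
  have hp1 : 0 ≤ p - 1 := by linarith
  have h0 : v ^ p ≠ 0 := by simp [ENNReal.rpow_eq_zero_iff_of_pos (by linarith : 0 < p), hv0]
  have ht : v ^ p ≠ ∞ := ENNReal.rpow_ne_top_of_nonneg (by linarith) hvt
  have hv : v ^ p = v * v ^ (p - 1) := by
    nth_rw 2 [← ENNReal.rpow_one v]
    rw [← ENNReal.rpow_add _ _ hv0 hvt]
    congr 1
    ring
  rw [← ENNReal.mul_le_mul_iff_left h0 ht]
  nth_rw 1 [hv]
  rw [mul_mul_mul_comm, ← ENNReal.mul_rpow_of_nonneg _ _ hp1, ENNReal.div_mul_cancel hv0 hvt,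
    ENNReal.div_mul_cancel hv0 hvt]

theorem apConst_le_iff {ι : Type*} [Fintype ι] {Ω : ι → Set ℝ}
    (hΩ : ∀ j, Ω j = Set.univ ∨ Ω j = Set.Ici 0) {k : ι → ℕ} {p : ℝ} (hp : 1 < p)
    {w : (ι → ℝ) → ℝ} {K : ℝ≥0∞} :
    apConst Ω k p w ≤ K ↔ BoxAp Ω k p (fun x => ENNReal.ofReal (w x)) K := by
  simp only [apConst, iSup_le_iff, BoxAp, box_subset_domain_iff hΩ, setLAverage_eq]
  refine forall₃_congr fun n a _ => ?_
  exact div_mul_div_rpow_le_iff hp (volume_box_ne_zero n a) (volume_box_ne_top n a)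

theorem BoxAp.congr_ae {ι : Type*} [Fintype ι] {Ω : ι → Set ℝ}
    (hΩ : ∀ j, Ω j = Set.univ ∨ Ω j = Set.Ici 0) {k : ι → ℕ} {p : ℝ} {W W' : (ι → ℝ) → ℝ≥0∞}
    {K : ℝ≥0∞} (h : BoxAp Ω k p W K) (hW : ∀ᵐ x ∂volume.restrict (domain Ω), W x = W' x) :
    BoxAp Ω k p W' K := by
  intro n a ha
  have hbox : ∀ᵐ x ∂volume.restrict (box k n a), W x = W' x :=
    ae_restrict_of_ae_restrict_of_subset ((box_subset_domain_iff hΩ n a).2 ha) hW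
  have := h n a ha
  rwa [lintegral_congr_ae hbox, lintegral_congr_ae (hbox.mono fun x hx => by
    rw [hx] : ∀ᵐ x ∂volume.restrict (box k n a), W x ^ (-1 / (p - 1)) = W' x ^ (-1 / (p - 1)))]
    at this

/-- An `A_p`-weight agrees almost everywhere with a measurable, everywhere positive function. -/
theorem IsApWeight.exists_measurable_pos {ι : Type*} [Fintype ι] {Ω : ι → Set ℝ} {k : ι → ℕ}
    {p : ℝ} {w : (ι → ℝ) → ℝ} (h : IsApWeight Ω k p w) :
    ∃ w' : (ι → ℝ) → ℝ, Measurable w' ∧ (∀ x, 0 < w' x) ∧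
      ∀ᵐ x ∂volume.restrict (domain Ω), w x = w' x := by
  classical
  have hm := h.aemeasurable.measurable_mk
  refine ⟨fun x => if 0 < h.aemeasurable.mk w x then h.aemeasurable.mk w x else 1,
    Measurable.ite (measurableSet_lt measurable_const hm) hm measurable_const, fun x => ?_, ?_⟩
  · dsimp only
    split_ifs with hx
    · exact hx
    · exact one_pos
  · filter_upwards [h.pos, h.aemeasurable.ae_eq_mk] with x h1 h2
    rw [← h2, if_pos h1]

variable {ι : Type*} [Fintype ι] [DecidableEq ι] {T : Finset ι}

/-- The initial tail consists of all coordinates only by virtue of `l 0 = 0`, so functions on the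
subtype and on the full space are identified by this change of variables. -/
theorem lintegral_eq_lintegral_updateFinset (hT : T = Finset.univ) (μ : ι → Measure ℝ)
    [∀ j, SigmaFinite (μ j)] (Φ : (ι → ℝ) → ℝ≥0∞) :
    ∫⁻ x, Φ x ∂Measure.pi μ =
      ∫⁻ y : T → ℝ, Φ (Function.updateFinset 0 T y) ∂Measure.pi (fun j : T => μ j) := by
  subst hT
  exact lintegral_eq_lmarginal_univ 0

theorem setLIntegral_box_restrict (hT : T = Finset.univ) {k : ι → ℕ} (n : ℤ) (a : ι → ℝ)
    (V : (T → ℝ) → ℝ≥0∞) :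
    ∫⁻ x in box k n a, V (T.restrict x) =
      ∫⁻ y in box (fun j : T => k j) n (T.restrict a), V y := by
  rw [← lintegral_indicator (measurableSet_box _ _), ← lintegral_indicator (measurableSet_box _ _),
    volume_pi, lintegral_eq_lintegral_updateFinset hT]
  refine lintegral_congr fun y => ?_
  have hmem : Function.updateFinset (0 : ι → ℝ) T y ∈ box k n a ↔
      y ∈ box (fun j : T => k j) n (T.restrict a) := by
    constructor
    · intro h j _
      have := h j trivial
      simpa [Function.updateFinset] using this
    · intro h j _
      have hj : j ∈ T := by simp [hT]
      have := h ⟨j, hj⟩ trivial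
      simpa [Function.updateFinset, hj] using this
  by_cases h : y ∈ box (fun j : T => k j) n (T.restrict a)
  · rw [Set.indicator_of_mem h, Set.indicator_of_mem (hmem.2 h), restrict_updateFinset_self]
  · rw [Set.indicator_of_notMem h, Set.indicator_of_notMem fun h' => h (hmem.1 h')]

theorem BoxAp.comp_restrict (hT : T = Finset.univ) {Ω : ι → Set ℝ} {k : ι → ℕ} {p : ℝ}
    {V : (T → ℝ) → ℝ≥0∞} {K : ℝ≥0∞} (h : BoxAp (fun j : T => Ω j) (fun j => k j) p V K) :
    BoxAp Ω k p (fun x => V (T.restrict x)) K := by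
  intro n a ha
  have hvol : volume (box k n a) = volume (box (fun j : T => k j) n (T.restrict a)) := by
    simpa using setLIntegral_box_restrict (k := k) hT n a fun _ => 1
  rw [setLIntegral_box_restrict hT, setLIntegral_box_restrict hT n a fun y => V y ^ (-1 / (p - 1)),
    hvol]
  exact h n _ fun j _ => ha j trivial

end Transfer

end MixedExtrapolation

/-! ### The extrapolation theorem for mixed norms -/

open MixedExtrapolation

theorem theorem8p1 (d m : ℕ) (hm : 0 < m)
    (p : Fin m → ℝ) (hp : ∀ i, 1 < p i)
    (k : Fin d → ℕ) (hk : ∀ j, 1 ≤ k j)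
    (K₀ : ℝ) (hK₀ : 1 < K₀) :
    ∃ Λ₀ : ℝ, 1 ≤ Λ₀ ∧ ∀ N₀ : ℝ, 0 < N₀ → ∃ N : ℝ, 0 < N ∧
      ∀ (Ω : Fin d → Set ℝ), (∀ j, Ω j = Set.univ ∨ Ω j = Set.Ici 0) →
      ∀ (l : Fin (m + 1) → ℕ), StrictMono l → l 0 = 0 → l (Fin.last m) = d →
      ∀ (w : (i : Fin m) → ((MixedExtrapolation.block (d := d) l i) → ℝ) → ℝ),
        (∀ i, MixedExtrapolation.IsApWeight (fun j : MixedExtrapolation.block l i => Ω j)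
            (fun j => k j) (p i) (w i) ∧
          MixedExtrapolation.apConst (fun j : MixedExtrapolation.block l i => Ω j)
            (fun j => k j) (p i) (w i) ≤ ENNReal.ofReal K₀) →
      ∀ (u g : (Fin d → ℝ) → ℝ),
        AEMeasurable u (volume.restrict (MixedExtrapolation.domain Ω)) →
        AEMeasurable g (volume.restrict (MixedExtrapolation.domain Ω)) →
        (∀ v : (Fin d → ℝ) → ℝ,
          MixedExtrapolation.IsApWeight Ω k (p ⟨0, hm⟩) v →
          MixedExtrapolation.apConst Ω k (p ⟨0, hm⟩) v ≤ ENNReal.ofReal Λ₀ →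
          MixedExtrapolation.weightedNorm Ω (p ⟨0, hm⟩) v u ≤
            ENNReal.ofReal N₀ * MixedExtrapolation.weightedNorm Ω (p ⟨0, hm⟩) v g) →
        MixedExtrapolation.mixedNorm Ω l p w u ≤
          ENNReal.ofReal N * MixedExtrapolation.mixedNorm Ω l p w g := by
  obtain ⟨Λ, hΛ, H⟩ := exists_const_mixedNorm_le hm hp hk
    (ENNReal.ofReal_ne_top (r := K₀)) 0
  refine ⟨max 1 Λ.toReal, le_max_left _ _, fun N₀ hN₀ => ?_⟩
  obtain ⟨N, hN0, hN, H⟩ := H (ENNReal.ofReal N₀) (by simpa using hN₀) ENNReal.ofReal_ne_top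
  refine ⟨N.toReal, ENNReal.toReal_pos hN0 hN, ?_⟩
  intro Ω hΩ l hl h0 hd w hw u g hu hg hyp
  have hp0 := hp ⟨0, hm⟩
  -- The induction works with measurable, everywhere positive weights; changing weights and
  -- functions on null sets alters neither the characteristics nor the mixed norms.
  choose w' hw'm hw'0 hw'eq using fun i => (hw i).1.exists_measurable_pos
  have hw'A : ∀ i, BoxAp (fun j : block (d := d) l i => Ω j) (fun j => k j) (p i)
      (fun x => ENNReal.ofReal (w' i x)) (ENNReal.ofReal K₀) := fun i =>
    have hΩi : ∀ j : block (d := d) l i, (fun j : block (d := d) l i => Ω j) j = Set.univ ∨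
        (fun j : block (d := d) l i => Ω j) j = Set.Ici 0 := fun j => hΩ j
    BoxAp.congr_ae hΩi ((apConst_le_iff hΩi (hp i)).1 (hw i).2)
      ((hw'eq i).mono fun x hx => by rw [hx])
  have hwae : ∀ i, ∀ᵐ y ∂Measure.pi (fun j : block (d := d) l i => volume.restrict (Ω j)),
      w i y = w' i y := fun i => by
    rw [← restrict_domain_eq_pi fun j : block (d := d) l i => Ω j]
    exact hw'eq i
  obtain ⟨u', hu', huae⟩ := hu
  obtain ⟨g', hg', hgae⟩ := hg
  have hupi := huae
  have hgpi := hgae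
  rw [restrict_domain_eq_pi] at hupi hgpi
  rw [mixedNorm_eq_of_ae hΩ hl h0 hd hwae hupi, mixedNorm_eq_of_ae hΩ hl h0 hd hwae hgpi,
    ENNReal.ofReal_toReal hN]
  refine H Ω hΩ l hl hd w' hw'm hw'0 hw'A u' g' hu' hg' fun V hV hVA => ?_
  have hT := tail_zero (d := d) h0
  -- `V` takes values in `(0, ∞)`, so passing to real values loses nothing and `v` is admissible in
  -- the hypothesis.
  set v : (Fin d → ℝ) → ℝ := fun x => (V ((tail l 0).restrict x)).toReal
  have hv : ∀ x, ENNReal.ofReal (v x) = V ((tail l 0).restrict x) := fun x =>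
    ENNReal.ofReal_toReal (hV.ne_top _)
  have hvA : apConst Ω k (p ⟨0, hm⟩) v ≤ Λ := by
    rw [apConst_le_iff hΩ hp0]
    simp_rw [hv]
    exact BoxAp.comp_restrict hT hVA
  have hvw : IsApWeight Ω k (p ⟨0, hm⟩) v :=
    ⟨(hV.measurable.comp (Finset.measurable_restrict _)).ennreal_toReal.aemeasurable,
      Filter.Eventually.of_forall fun x => ENNReal.toReal_pos (hV.ne_zero _) (hV.ne_top _),
      hvA.trans_lt hΛ.lt_top⟩
  have hnorm : ∀ {f f' : (Fin d → ℝ) → ℝ}, (∀ᵐ x ∂volume.restrict (domain Ω), f x = f' x) →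
      lpNormW (volume.restrict (domain fun j : tail (d := d) l 0 => Ω j)) (p ⟨0, hm⟩) V
        (fun y => partialMixedNorm Ω l p w' f' 0 (Function.updateFinset 0 _ y)) =
      weightedNorm Ω (p ⟨0, hm⟩) v f := by
    intro f f' hff'
    have h1 : ∫⁻ x in domain Ω, ‖f x‖ₑ ^ p ⟨0, hm⟩ * ENNReal.ofReal (v x) =
        ∫⁻ x in domain Ω, ‖f' x‖ₑ ^ p ⟨0, hm⟩ * V ((tail l 0).restrict x) := by
      refine lintegral_congr_ae (hff'.mono fun x hx => ?_)
      dsimp only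
      rw [hx, hv]
    rw [weightedNorm, h1, restrict_domain_eq_pi Ω, lintegral_eq_lintegral_updateFinset hT,
      lpNormW, restrict_domain_eq_pi]
    simp_rw [restrict_updateFinset_self]
    rfl
  have hfinal := hyp v hvw (hvA.trans
    ((ENNReal.ofReal_toReal hΛ).ge.trans (ENNReal.ofReal_le_ofReal (le_max_right _ _))))
  rw [← hnorm huae, ← hnorm hgae] at hfinal
  exact hfinal
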